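/- Let $\mathcal U\subset\mathbb R^N$ be open, and let $f:\mathcal U\to\mathbb R^N$ and $B:\mathcal U\to\mathbb R^{N\times N}$ be smooth. Assume strict hyperbolicity: for every $u\in\mathcal U$ the matrix $\nabla f(u)$ has real eigenvalues $\lambda_1(u)<\dots<\lambda_N(u)$, with eigenvectors $r_1(u),\dots,r_N(u)$. For an open set $\mathcal V\subset\mathcal U$ and $u_B\in\mathcal V$ let $\mathcal E_{\mathcal V}(u_B)$ be the set of all $v_\infty\in\mathcal V$ for which the problem $$B(v)\,\partial_y v=f(v)-f(v_\infty),\qquad v(0)=u_B,\qquad \lim_{y\to\infty}v(y)=v_\infty$$ has a smooth solution $v:[0,\infty)\to\mathcal V$; the viscous boundary-layer set is $\mathcal E^{\text{layer}}_{\text{viscosity}}(u_B)=\mathcal E_{\mathcal U}(u_B)$. A $B$-convex entropy pair on $\mathcal U$ is a pair of $C^2$ functions $U,F:\mathcal U\to\mathbb R$ with $\nabla F^T=\nabla U^T\nabla f$ and $h^T\nabla^2U(u)B(u)h>0$ for all $u\in\mathcal U$ and $h\ne0$. Let $u_B\in\mathcal U$ and $0\le p\le N$, and assume that for all $u$ in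 a neighbourhood of $u_B$ every $r_j(u)$ is an eigenvector of $B(u)$ with a positive eigenvalue, $\lambda_j(u)<0$ for $j\le p$, and $\lambda_j(u)\ge0$ for $j>p$ (for $1\le p<N$ this is $\lambda_p(u)<0\le\lambda_{p+1}(u)$). Then: 1. $u_B\in\mathcal E^{\text{layer}}_{\text{viscosity}}(u_B)$, and $\mathcal E^{\text{layer}}_{\text{viscosity}}(u_B)$ contains a $p$-dimensional embedded $C^1$ submanifold of $\mathbb R^N$ passing through $u_B$. 2. Suppose moreover that $\lambda_j(u_B)>0$ for all $j>p$ (that is, $\lambda_{p+1}(u_B)>0$ if $p<N$). (a) If there is a $B$-convex entropy pair on $\mathcal U$, then $u_B$ has an open neighbourhood $W$ such that $\mathcal E^{\text{layer}}_{\text{viscosity}}(u_B)\cap W$ is an embedded $C^1$ submanifold of dimension exactly $p$ whose tangent space at $u_B$ is spanned by $r_1(u_B),\dots,r_p(u_B)$. (b) Without any assumption on entropies, $u_B$ has an open neighbourhood $\mathcal U_0\subset\mathcal U$ such that for every open $\mathcal V\subset\mathcal U_0$ containing $u_B$ the conclusion of (a) holds for $\mathcal E_{\mathcal V}(u_B)$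 in place of $\mathcal E^{\text{layer}}_{\text{viscosity}}(u_B)$, with some $W$ depending on $\mathcal V$. -/

import Mathlib

open Set Filter Topology
open scoped ContDiff

/-- The layer set of the state domain `𝒰`, the flux `f`, the viscosity matrix `B` and the boundary
state `uB`: all `w ∈ 𝒰` for which `B(v) v' = f(v) - f(w)`, `v(0) = uB`, `v(y) → w` as `y → ∞`
has a smooth solution `v : [0, ∞) → 𝒰`. At `y = 0` the derivative is one-sided. -/
def viscousLayerSet {N : ℕ} (𝒰 : Set (EuclideanSpace ℝ (Fin N)))
    (f : EuclideanSpace ℝ (Fin N) → EuclideanSpace ℝ (Fin N))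
    (B : EuclideanSpace ℝ (Fin N) → EuclideanSpace ℝ (Fin N) →L[ℝ] EuclideanSpace ℝ (Fin N))
    (uB : EuclideanSpace ℝ (Fin N)) : Set (EuclideanSpace ℝ (Fin N)) :=
  {w | w ∈ 𝒰 ∧ ∃ v : ℝ → EuclideanSpace ℝ (Fin N),
    ContDiffOn ℝ ∞ v (Ici 0) ∧
    (∀ y, 0 ≤ y → v y ∈ 𝒰) ∧
    (∀ y, 0 ≤ y → B (v y) (derivWithin v (Ici 0) y) = f (v y) - f w) ∧
    v 0 = uB ∧
    Tendsto v atTop (𝓝 w)}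

/-- `(U, F)` is a `B`-convex entropy pair on `𝒰` for the flux `f`: both functions are `C²`,
`∇F = ∇U ∇f`, and `∇²U B > 0` as a quadratic form. -/
def IsBConvexEntropyPair {N : ℕ} (𝒰 : Set (EuclideanSpace ℝ (Fin N)))
    (f : EuclideanSpace ℝ (Fin N) → EuclideanSpace ℝ (Fin N))
    (B : EuclideanSpace ℝ (Fin N) → EuclideanSpace ℝ (Fin N) →L[ℝ] EuclideanSpace ℝ (Fin N))
    (U F : EuclideanSpace ℝ (Fin N) → ℝ) : Prop :=
  ContDiffOn ℝ 2 U 𝒰 ∧ ContDiffOn ℝ 2 F 𝒰 ∧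
  (∀ u ∈ 𝒰, fderiv ℝ F u = (fderiv ℝ U u).comp (fderiv ℝ f u)) ∧
  (∀ u ∈ 𝒰, ∀ h, h ≠ 0 → 0 < fderiv ℝ (fderiv ℝ U) u h (B u h))

/-- `M` is an embedded `C¹` submanifold of dimension `p`: around each of its points a `C¹`
diffeomorphism between open sets straightens `M` to a `p`-dimensional linear subspace. -/
def IsC1Submanifold {N : ℕ} (p : ℕ) (M : Set (EuclideanSpace ℝ (Fin N))) : Prop :=
  ∀ x ∈ M, ∃ (Φ : OpenPartialHomeomorph (EuclideanSpace ℝ (Fin N)) (EuclideanSpace ℝ (Fin N)))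
    (L : Submodule ℝ (EuclideanSpace ℝ (Fin N))),
    x ∈ Φ.source ∧
    ContDiffOn ℝ 1 Φ Φ.source ∧ ContDiffOn ℝ 1 Φ.symm Φ.target ∧
    Module.finrank ℝ L = p ∧
    ∀ z ∈ Φ.source, z ∈ M ↔ Φ z ∈ L

/-- The tangent vectors of `M` at `x`: velocities at time `0` of `C¹` curves in `M` through `x`. -/
def tangentVectors {N : ℕ} (M : Set (EuclideanSpace ℝ (Fin N))) (x : EuclideanSpace ℝ (Fin N)) :
    Set (EuclideanSpace ℝ (Fin N)) :=
  {w | ∃ γ : ℝ → EuclideanSpace ℝ (Fin N),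
    ContDiffAt ℝ 1 γ 0 ∧ γ 0 = x ∧ deriv γ 0 = w ∧ ∀ᶠ t in 𝓝 0, γ t ∈ M}

/-- Near its point `x`, the set `S` is a `C¹` submanifold of dimension `p` whose tangent space
at `x` is `T`. -/
def IsLocallySubmanifoldAt {N : ℕ} (p : ℕ) (S : Set (EuclideanSpace ℝ (Fin N)))
    (x : EuclideanSpace ℝ (Fin N)) (T : Submodule ℝ (EuclideanSpace ℝ (Fin N))) : Prop :=
  ∃ W : Set (EuclideanSpace ℝ (Fin N)), IsOpen W ∧ x ∈ W ∧ x ∈ S ∧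
    IsC1Submanifold p (S ∩ W) ∧ tangentVectors (S ∩ W) x = (T : Set (EuclideanSpace ℝ (Fin N)))

/-
Where `B` is invertible the layer equation reads `v' = Q(v, w) (v - w)` with `Q` of class `C¹`. Put
`v = w + exp(-η y) ζ` with a small `η ≥ 0`: if `Q(u, u)` is diagonal with entries `μ j`, then the
linearization for `ζ` at `w = u` is diagonal with entries `μ j + η ≠ 0`, hence solvable on bounded
functions of `y ≥ 0` with prescribed stable coordinates at `y = 0`, and the implicit function
theorem gives a `C¹` family `Z w` of bounded solutions with the stable coordinates of `u - w`. So `w` is a limit state as soon as the unstable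
coordinates of `Z w 0` are those of `u - w` too, i.e. as soon as `θ w = w - u + P (Z w 0)` lies in
the stable subspace, where `P` is the unstable projection. As `Z` has no unstable part to first
order at `u`, the map `θ` is tangent to the identity, hence a chart.

If no `μ j` vanishes, the same construction with `η = 0` is unique among all profiles that stay
near `u`, so these reach no other limit state. A `B`-convex entropy confines every profile with
limit near `u`: the entropy excess over `w` plus a small multiple of `‖v - w‖²` decreases.
-/

open scoped NNReal BoundedContinuousFunction

section Superposition

variable {X : Type*} [TopologicalSpace X]
  {E : Type*} [NormedAddCommGroup E] {F : Type*} [NormedAddCommGroup F]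

/-- The superposition (Nemytskii) operator `ζ ↦ φ ∘ ζ` on bounded continuous functions. -/
def superposition [ProperSpace E] (φ : E → F) (hφ : Continuous φ) (ζ : X →ᵇ E) : X →ᵇ F where
  toFun x := φ (ζ x)
  continuous_toFun := hφ.comp ζ.continuous
  map_bounded' := by
    obtain ⟨C, hC⟩ := Metric.isBounded_iff.1
      ((isCompact_closedBall (0 : E) ‖ζ‖).image hφ).isBounded
    exact ⟨C, fun x y => hC
      (mem_image_of_mem φ (mem_closedBall_zero_iff.2 (ζ.norm_coe_le_norm x)))
      (mem_image_of_mem φ (mem_closedBall_zero_iff.2 (ζ.norm_coe_le_norm y)))⟩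

@[simp]
theorem superposition_apply [ProperSpace E] (φ : E → F) (hφ : Continuous φ) (ζ : X →ᵇ E) (x : X) :
    superposition φ hφ ζ x = φ (ζ x) := rfl

theorem exists_uniform_modulus [ProperSpace E] {φ : E → F} (hφ : Continuous φ) (ζ : X →ᵇ E)
    {ε : ℝ} (hε : 0 < ε) :
    ∃ δ > 0, ∀ x, ∀ e, ‖e - ζ x‖ < δ → ‖φ e - φ (ζ x)‖ < ε := by
  have hunif := (isCompact_closedBall (0 : E) (‖ζ‖ + 1)).uniformContinuousOn_of_continuous
    hφ.continuousOn
  obtain ⟨δ, hδ, h⟩ := Metric.uniformContinuousOn_iff.1 hunif ε hε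
  refine ⟨min δ 1, by positivity, fun x e he => ?_⟩
  have hζx : ‖ζ x‖ ≤ ‖ζ‖ := ζ.norm_coe_le_norm x
  have he_norm : ‖e‖ ≤ ‖ζ‖ + 1 :=
    calc ‖e‖ ≤ ‖ζ x‖ + ‖e - ζ x‖ := norm_le_norm_add_norm_sub' e (ζ x)
      _ ≤ ‖ζ‖ + 1 := add_le_add hζx (he.trans_le (min_le_right _ _)).le
  rw [← dist_eq_norm]
  refine h e (mem_closedBall_zero_iff.2 he_norm) (ζ x)
    (mem_closedBall_zero_iff.2 (by linarith)) ?_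
  rw [dist_eq_norm]
  exact he.trans_le (min_le_left _ _)

theorem continuous_superposition [ProperSpace E] {φ : E → F} (hφ : Continuous φ) :
    Continuous (superposition (X := X) φ hφ) := by
  refine Metric.continuous_iff.2 fun ζ ε hε => ?_
  obtain ⟨δ, hδ, h⟩ := exists_uniform_modulus hφ ζ (half_pos hε)
  refine ⟨δ, hδ, fun ξ hξ => lt_of_le_of_lt
    ((BoundedContinuousFunction.dist_le (half_pos hε).le).2 fun x => ?_) (half_lt_self hε)⟩
  rw [dist_eq_norm]
  refine (h x (ξ x) ?_).le
  rw [← dist_eq_norm]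
  exact (BoundedContinuousFunction.dist_coe_le_dist x).trans_lt hξ

variable [NormedSpace ℝ E] [NormedSpace ℝ F]

/-- Pointwise application of operator-valued functions, as a continuous bilinear map. -/
noncomputable def pointwiseApply (X : Type*) [TopologicalSpace X]
    (E : Type*) [NormedAddCommGroup E] [NormedSpace ℝ E]
    (F : Type*) [NormedAddCommGroup F] [NormedSpace ℝ F] :
    (X →ᵇ (E →L[ℝ] F)) →L[ℝ] (X →ᵇ E) →L[ℝ] (X →ᵇ F) :=
  LinearMap.mkContinuous₂
    (LinearMap.mk₂ ℝ
      (fun (M : X →ᵇ (E →L[ℝ] F)) (ζ : X →ᵇ E) =>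
        BoundedContinuousFunction.ofNormedAddCommGroup (fun x => M x (ζ x))
          (M.continuous.clm_apply ζ.continuous) (‖M‖ * ‖ζ‖) fun x =>
            (M x).le_of_opNorm_le_of_le (M.norm_coe_le_norm x) (ζ.norm_coe_le_norm x))
      (fun _ _ _ => by ext; simp) (fun _ _ _ => by ext; simp)
      (fun _ _ _ => by ext; simp) (fun _ _ _ => by ext; simp))
    1 (fun M ζ => by
      rw [one_mul]
      exact (BoundedContinuousFunction.norm_le (by positivity)).2 fun x =>
        (M x).le_of_opNorm_le_of_le (M.norm_coe_le_norm x) (ζ.norm_coe_le_norm x))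

@[simp]
theorem pointwiseApply_apply (M : X →ᵇ (E →L[ℝ] F)) (ζ : X →ᵇ E) (x : X) :
    pointwiseApply X E F M ζ x = M x (ζ x) := rfl

/-- The embedding of a normed space as the constant functions. -/
noncomputable def constCLM (X : Type*) [TopologicalSpace X]
    (E : Type*) [NormedAddCommGroup E] [NormedSpace ℝ E] : E →L[ℝ] (X →ᵇ E) :=
  LinearMap.mkContinuous
    { toFun := BoundedContinuousFunction.const X
      map_add' := fun _ _ => rfl
      map_smul' := fun _ _ => rfl }
    1 fun e => (BoundedContinuousFunction.norm_const_le e).trans (one_mul ‖e‖).ge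

@[simp]
theorem constCLM_apply (e : E) (x : X) : constCLM X E e x = e := rfl

theorem hasFDerivAt_superposition [ProperSpace E] {φ : E → F} (hφ : ContDiff ℝ 1 φ)
    (ζ : X →ᵇ E) :
    HasFDerivAt (superposition (X := X) φ hφ.continuous)
      (pointwiseApply X E F
        (superposition (fderiv ℝ φ) (hφ.continuous_fderiv one_ne_zero) ζ)) ζ := by
  rw [hasFDerivAt_iff_isLittleO, Asymptotics.isLittleO_iff]
  intro ε hε
  obtain ⟨δ, hδ, h⟩ := exists_uniform_modulus (hφ.continuous_fderiv one_ne_zero) ζ hε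
  filter_upwards [Metric.ball_mem_nhds ζ hδ] with ξ hξ
  refine (BoundedContinuousFunction.norm_le (by positivity)).2 fun x => ?_
  have hx : ‖ξ x - ζ x‖ ≤ ‖ξ - ζ‖ := (ξ - ζ).norm_coe_le_norm x
  have hxδ : ‖ξ x - ζ x‖ < δ := hx.trans_lt (by simpa [dist_eq_norm] using hξ)
  have hmean := (convex_ball (ζ x) δ).norm_image_sub_le_of_norm_fderiv_le'
    (f := φ) (φ := fderiv ℝ φ (ζ x)) (C := ε) (x := ζ x) (y := ξ x)
    (fun e _ => (hφ.differentiable one_ne_zero) e)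
    (fun e he => (h x e (by simpa [dist_eq_norm] using he)).le)
    (Metric.mem_ball_self hδ) (by simpa [dist_eq_norm] using hxδ)
  simpa using hmean.trans (mul_le_mul_of_nonneg_left hx hε.le)

theorem contDiff_superposition [ProperSpace E] {φ : E → F} (hφ : ContDiff ℝ 1 φ) :
    ContDiff ℝ 1 (superposition (X := X) φ hφ.continuous) :=
  contDiff_one_iff_hasFDerivAt.2 ⟨_, (pointwiseApply X E F).continuous.comp
    (continuous_superposition (hφ.continuous_fderiv one_ne_zero)),
    hasFDerivAt_superposition hφ⟩

end Superposition

section HadamardFactor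

variable {E : Type*} [NormedAddCommGroup E] [NormedSpace ℝ E]
  {F : Type*} [NormedAddCommGroup F] [NormedSpace ℝ F]

/-- Integration over the unit interval, as a continuous linear map. -/
noncomputable def unitIntervalMean (F : Type*) [NormedAddCommGroup F] [NormedSpace ℝ F] :
    (unitInterval →ᵇ F) →L[ℝ] F :=
  LinearMap.mkContinuous
    { toFun := fun h => ∫ t in (0 : ℝ)..1, h (projIcc 0 1 zero_le_one t)
      map_add' := fun g h => intervalIntegral.integral_add
        ((g.continuous.comp continuous_projIcc).intervalIntegrable _ _)
        ((h.continuous.comp continuous_projIcc).intervalIntegrable _ _)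
      map_smul' := fun c _ => intervalIntegral.integral_smul c _ }
    1 fun h => by
      simpa using intervalIntegral.norm_integral_le_of_norm_le_const (a := 0) (b := 1) (C := ‖h‖)
        (f := fun t => h (projIcc 0 1 zero_le_one t)) fun t _ => h.norm_coe_le_norm _

theorem unitIntervalMean_eq_integral {g : ℝ → F} {h : unitInterval →ᵇ F}
    (hgh : ∀ t : unitInterval, h t = g t) :
    unitIntervalMean F h = ∫ t in (0 : ℝ)..1, g t :=
  intervalIntegral.integral_congr fun t ht => by
    rw [uIcc_of_le zero_le_one] at ht
    simp only [hgh, projIcc_of_mem zero_le_one ht]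

/-- The segments `t ↦ w + t (v - w)`, as a continuous linear function of `(v, w)`. -/
noncomputable def segmentMap (E : Type*) [NormedAddCommGroup E] [NormedSpace ℝ E] :
    E × E →L[ℝ] (unitInterval →ᵇ E) :=
  pointwiseApply unitInterval (E × E) E
    (BoundedContinuousFunction.mkOfCompact
      ⟨fun t => ContinuousLinearMap.snd ℝ E E +
        (t : ℝ) • (ContinuousLinearMap.fst ℝ E E - ContinuousLinearMap.snd ℝ E E), by fun_prop⟩) ∘L
    constCLM unitInterval (E × E)

theorem segmentMap_apply (v w : E) (t : unitInterval) :
    segmentMap E (v, w) t = w + (t : ℝ) • (v - w) := rfl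

theorem integral_fderiv_segment_apply [CompleteSpace F] {f : E → F} (hf : ContDiff ℝ 1 f)
    (v w : E) :
    (∫ t in (0 : ℝ)..1, fderiv ℝ f (w + t • (v - w))) (v - w) = f v - f w := by
  have hcont : Continuous fun t : ℝ => fderiv ℝ f (w + t • (v - w)) :=
    (hf.continuous_fderiv one_ne_zero).comp (by fun_prop)
  have hderiv : ∀ t ∈ uIcc (0 : ℝ) 1, HasDerivAt (fun t : ℝ => f (w + t • (v - w)))
      (fderiv ℝ f (w + t • (v - w)) (v - w)) t := fun t _ => by
    have hsegment : HasDerivAt (fun t : ℝ => w + t • (v - w)) (v - w) t := by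
      simpa using ((hasDerivAt_id t).smul_const (v - w)).const_add w
    exact (hf.differentiable one_ne_zero _).hasFDerivAt.comp_hasDerivAt t hsegment
  rw [ContinuousLinearMap.intervalIntegral_apply (hcont.intervalIntegrable _ _),
    intervalIntegral.integral_eq_sub_of_hasDerivAt hderiv
      ((hcont.clm_apply continuous_const).intervalIntegrable _ _)]
  simp

theorem exists_contDiff_factor [ProperSpace E] [CompleteSpace F] {f : E → F}
    (hf : ContDiff ℝ 2 f) :
    ∃ q : E × E → (E →L[ℝ] F), ContDiff ℝ 1 q ∧ (∀ v w, q (v, w) (v - w) = f v - f w) ∧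
      ∀ u, q (u, u) = fderiv ℝ f u := by
  have hdf : ContDiff ℝ 1 (fderiv ℝ f) := hf.fderiv_right one_add_one_eq_two.le
  have hmean : ∀ v w, unitIntervalMean _
      (superposition (fderiv ℝ f) hdf.continuous (segmentMap E (v, w))) =
      ∫ t in (0 : ℝ)..1, fderiv ℝ f (w + t • (v - w)) := fun v w =>
    unitIntervalMean_eq_integral fun t => by rw [superposition_apply, segmentMap_apply]
  refine ⟨fun z => unitIntervalMean _
    (superposition (fderiv ℝ f) hdf.continuous (segmentMap E z)), ?_, fun v w => ?_, fun u => ?_⟩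
  · exact (unitIntervalMean _).contDiff.comp
      ((contDiff_superposition hdf).comp (segmentMap E).contDiff)
  · simp only [hmean]
    exact integral_fderiv_segment_apply (hf.of_le one_le_two) v w
  · simp [hmean]

end HadamardFactor

theorem exists_contDiff_eventuallyEq {E : Type*} [NormedAddCommGroup E] [NormedSpace ℝ E]
    [FiniteDimensional ℝ E] {F : Type*} [NormedAddCommGroup F] [NormedSpace ℝ F] {n : ℕ}
    {f : E → F} {x : E} (hf : ContDiffAt ℝ n f x) :
    ∃ g : E → F, ContDiff ℝ n g ∧ g =ᶠ[𝓝 x] f := by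
  obtain ⟨ε, hε, hball⟩ := Metric.eventually_nhds_iff_ball.1 (hf.eventually (by simp))
  let χ : ContDiffBump x := ⟨ε / 3, ε / 2, by positivity, by linarith⟩
  refine ⟨fun y => χ y • f y, contDiff_iff_contDiffAt.2 fun y => ?_, ?_⟩
  · by_cases hy : y ∈ Metric.ball x ε
    · exact χ.contDiff.contDiffAt.smul (hball y hy)
    · have hysupport : y ∉ tsupport χ := by
        rw [χ.tsupport_eq]
        exact fun hmem => hy (Metric.closedBall_subset_ball (half_lt_self hε) hmem)
      have hzero : (fun y => χ y • f y) =ᶠ[𝓝 y] fun _ => 0 := by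
        filter_upwards [notMem_tsupport_iff_eventuallyEq.1 hysupport] with z hz
        rw [hz, Pi.zero_apply, zero_smul]
      exact contDiffAt_const.congr_of_eventuallyEq hzero
  · filter_upwards [χ.eventuallyEq_one] with y hy
    rw [hy, Pi.one_apply, one_smul]

section HalfLine

variable {F : Type*} [NormedAddCommGroup F]

/-- The extension to the real line of a function on the half line, constant for negative times. -/
def extendHalfLine (x : ℝ≥0 →ᵇ F) (y : ℝ) : F := x y.toNNReal

@[simp]
theorem extendHalfLine_coe (x : ℝ≥0 →ᵇ F) (y : ℝ≥0) : extendHalfLine x y = x y := by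
  simp [extendHalfLine]

@[simp]
theorem extendHalfLine_zero (x : ℝ≥0 →ᵇ F) : extendHalfLine x 0 = x 0 := by
  simp [extendHalfLine]

theorem continuous_extendHalfLine (x : ℝ≥0 →ᵇ F) : Continuous (extendHalfLine x) :=
  x.continuous.comp continuous_real_toNNReal

theorem norm_extendHalfLine_le (x : ℝ≥0 →ᵇ F) (y : ℝ) : ‖extendHalfLine x y‖ ≤ ‖x‖ :=
  x.norm_coe_le_norm _

variable [NormedSpace ℝ F]

/-- `x` is differentiable on the half line with derivative `x'`; at time `0` the derivative is
one-sided. -/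
def HasHalfLineDeriv (x : ℝ≥0 →ᵇ F) (x' : ℝ≥0 → F) : Prop :=
  ∀ y : ℝ≥0, HasDerivWithinAt (extendHalfLine x) (x' y) (Ici 0) y

namespace HasHalfLineDeriv

variable {x z : ℝ≥0 →ᵇ F} {x' z' : ℝ≥0 → F}

theorem congr_deriv (hx : HasHalfLineDeriv x x') (h : ∀ y, x' y = z' y) : HasHalfLineDeriv x z' :=
  fun y => (hx y).congr_deriv (h y)

theorem add (hx : HasHalfLineDeriv x x') (hz : HasHalfLineDeriv z z') :
    HasHalfLineDeriv (x + z) (x' + z') :=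
  fun y => (hx y).add (hz y)

theorem sub (hx : HasHalfLineDeriv x x') (hz : HasHalfLineDeriv z z') :
    HasHalfLineDeriv (x - z) (x' - z') :=
  fun y => (hx y).sub (hz y)

theorem const_smul (c : ℝ) (hx : HasHalfLineDeriv x x') : HasHalfLineDeriv (c • x) (c • x') :=
  fun y => (hx y).const_smul c

end HasHalfLineDeriv

theorem hasHalfLineDeriv_of_hasDerivWithinAt {x : ℝ≥0 →ᵇ F} {x' : ℝ≥0 → F} {v : ℝ → F}
    (hxv : ∀ y : ℝ≥0, x y = v y) (hv : ∀ y : ℝ≥0, HasDerivWithinAt v (x' y) (Ici 0) y) :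
    HasHalfLineDeriv x x' := fun y =>
  (hv y).congr (fun t ht => by lift t to ℝ≥0 using ht; rw [extendHalfLine_coe, hxv])
    (by rw [extendHalfLine_coe, hxv])

end HalfLine

section ScalarEquation

theorem hasDerivAt_exp_const_mul (a y : ℝ) :
    HasDerivAt (fun t => Real.exp (a * t)) (a * Real.exp (a * y)) y := by
  simpa [mul_comm] using ((hasDerivAt_id y).const_mul a).exp

theorem exp_mul_mul_exp_neg_mul (a y : ℝ) : Real.exp (a * y) * Real.exp (-a * y) = 1 := by
  rw [← Real.exp_add, neg_mul, add_neg_cancel, Real.exp_zero]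

theorem hasDerivAt_exp_mul_primitive (a k : ℝ) {h : ℝ → ℝ} (hh : Continuous h) (y : ℝ) :
    HasDerivAt (fun y => Real.exp (a * y) * (k + ∫ s in (0 : ℝ)..y, Real.exp (-a * s) * h s))
      (a * (Real.exp (a * y) * (k + ∫ s in (0 : ℝ)..y, Real.exp (-a * s) * h s)) + h y) y := by
  have hcont : Continuous fun s => Real.exp (-a * s) * h s := by fun_prop
  have hprimitive := (intervalIntegral.integral_hasDerivAt_right (hcont.intervalIntegrable 0 y)
    (hcont.stronglyMeasurableAtFilter _ _) hcont.continuousAt).const_add k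
  refine ((hasDerivAt_exp_const_mul a y).mul hprimitive).congr_deriv ?_
  linear_combination h y * exp_mul_mul_exp_neg_mul a y

theorem norm_exp_mul_le {h : ℝ → ℝ} {C : ℝ} (hC : ∀ s, ‖h s‖ ≤ C) (a s : ℝ) :
    ‖Real.exp (a * s) * h s‖ ≤ Real.exp (a * s) * C := by
  rw [norm_mul, Real.norm_of_nonneg (Real.exp_pos _).le]
  gcongr
  exact hC s

theorem abs_exp_mul_integral_le {a : ℝ} (ha : a < 0) {h : ℝ → ℝ} {C : ℝ} (hC : ∀ s, ‖h s‖ ≤ C)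
    {y : ℝ} (hy : 0 ≤ y) :
    |Real.exp (a * y) * ∫ s in (0 : ℝ)..y, Real.exp (-a * s) * h s| ≤ |a|⁻¹ * C := by
  have hC0 : 0 ≤ C := (norm_nonneg _).trans (hC 0)
  have hbound : |∫ s in (0 : ℝ)..y, Real.exp (-a * s) * h s| ≤
      ∫ s in (0 : ℝ)..y, Real.exp (-a * s) * C :=
    intervalIntegral.norm_integral_le_of_norm_le hy
      (Eventually.of_forall fun s _ => norm_exp_mul_le hC _ s)
      ((by fun_prop : Continuous fun s => Real.exp (-a * s) * C).intervalIntegrable _ _)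
  have hint : ∫ s in (0 : ℝ)..y, Real.exp (-a * s) * C =
      (-a)⁻¹ * (Real.exp (-a * y) - 1) * C := by
    rw [intervalIntegral.integral_mul_const,
      intervalIntegral.integral_comp_mul_left _ (neg_ne_zero.2 ha.ne)]
    simp
  have hinv : 0 < (-a)⁻¹ := inv_pos.2 (neg_pos.2 ha)
  rw [abs_mul, abs_of_pos (Real.exp_pos _), abs_of_neg ha]
  calc Real.exp (a * y) * |∫ s in (0 : ℝ)..y, Real.exp (-a * s) * h s|
      ≤ Real.exp (a * y) * ((-a)⁻¹ * (Real.exp (-a * y) - 1) * C) := by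
        rw [← hint]; gcongr
    _ = (-a)⁻¹ * (1 - Real.exp (a * y)) * C := by
        linear_combination ((-a)⁻¹ * C) * exp_mul_mul_exp_neg_mul a y
    _ ≤ (-a)⁻¹ * 1 * C := by
        gcongr
        exact sub_le_self 1 (Real.exp_pos _).le
    _ = (-a)⁻¹ * C := by rw [mul_one]

theorem abs_exp_mul_integral_Ioi_le {a : ℝ} (ha : 0 < a) {h : ℝ → ℝ} {C : ℝ}
    (hC : ∀ s, ‖h s‖ ≤ C) (y : ℝ) :
    |Real.exp (a * y) * ∫ s in Ioi y, Real.exp (-a * s) * h s| ≤ |a|⁻¹ * C := by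
  have hbound : |∫ s in Ioi y, Real.exp (-a * s) * h s| ≤ ∫ s in Ioi y, Real.exp (-a * s) * C :=
    MeasureTheory.norm_integral_le_of_norm_le
      ((integrableOn_exp_mul_Ioi (neg_lt_zero.2 ha) y).mul_const _)
      (Eventually.of_forall (norm_exp_mul_le hC _))
  have hint : ∫ s in Ioi y, Real.exp (-a * s) * C = a⁻¹ * Real.exp (-a * y) * C := by
    rw [MeasureTheory.integral_mul_const, integral_exp_mul_Ioi (neg_lt_zero.2 ha)]
    field_simp
  rw [abs_mul, abs_of_pos (Real.exp_pos _), abs_of_pos ha]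
  calc Real.exp (a * y) * |∫ s in Ioi y, Real.exp (-a * s) * h s|
      ≤ Real.exp (a * y) * (a⁻¹ * Real.exp (-a * y) * C) := by
        rw [← hint]; gcongr
    _ = a⁻¹ * C := by linear_combination (a⁻¹ * C) * exp_mul_mul_exp_neg_mul a y

theorem exists_boundedPrimitive {a : ℝ} (ha : a ≠ 0) (c : ℝ) (h : ℝ≥0 →ᵇ ℝ) :
    ∃ k : ℝ, (a < 0 → k = c) ∧ ∀ y : ℝ, 0 ≤ y →
      |Real.exp (a * y) * (k + ∫ s in (0 : ℝ)..y, Real.exp (-a * s) * extendHalfLine h s)| ≤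
        |c| + |a|⁻¹ * ‖h‖ := by
  have hC := norm_extendHalfLine_le h
  rcases ha.lt_or_gt with hneg | hpos
  · refine ⟨c, fun _ => rfl, fun y hy => ?_⟩
    rw [mul_add]
    refine (abs_add_le _ _).trans (add_le_add ?_ (abs_exp_mul_integral_le hneg hC hy))
    rw [abs_mul, abs_of_pos (Real.exp_pos _)]
    exact mul_le_of_le_one_left (abs_nonneg c)
      (Real.exp_le_one_iff.2 (mul_nonpos_of_nonpos_of_nonneg hneg.le hy))
  · have hintegrable (y : ℝ) : MeasureTheory.IntegrableOn
        (fun s => Real.exp (-a * s) * extendHalfLine h s) (Ioi y) :=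
      (integrableOn_exp_mul_Ioi (neg_lt_zero.2 hpos) y).mul_bdd (c := ‖h‖)
        (continuous_extendHalfLine h).aestronglyMeasurable (Eventually.of_forall hC)
    refine ⟨-∫ s in Ioi (0 : ℝ), Real.exp (-a * s) * extendHalfLine h s,
      fun hneg => absurd hneg hpos.not_gt, fun y _ => ?_⟩
    rw [← intervalIntegral.integral_interval_add_Ioi (hintegrable 0) (hintegrable y),
      neg_add_rev, neg_add_cancel_right, mul_neg, abs_neg]
    exact (abs_exp_mul_integral_Ioi_le hpos hC y).trans (le_add_of_nonneg_left (abs_nonneg c))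

theorem exists_bounded_solution {a : ℝ} (ha : a ≠ 0) (c : ℝ) (h : ℝ≥0 →ᵇ ℝ) :
    ∃ x : ℝ≥0 →ᵇ ℝ, (a < 0 → x 0 = c) ∧ HasHalfLineDeriv x (fun y => a * x y + h y) ∧
      ‖x‖ ≤ |c| + |a|⁻¹ * ‖h‖ := by
  obtain ⟨k, hk, hbound⟩ := exists_boundedPrimitive ha c h
  let X : ℝ → ℝ := fun y =>
    Real.exp (a * y) * (k + ∫ s in (0 : ℝ)..y, Real.exp (-a * s) * extendHalfLine h s)
  have hX (y : ℝ) : HasDerivAt X (a * X y + extendHalfLine h y) y :=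
    hasDerivAt_exp_mul_primitive a k (continuous_extendHalfLine h) y
  have hXcont : Continuous X := continuous_iff_continuousAt.2 fun y => (hX y).continuousAt
  let x : ℝ≥0 →ᵇ ℝ := BoundedContinuousFunction.ofNormedAddCommGroup (fun y => X y)
    (hXcont.comp NNReal.continuous_coe) _ fun y => hbound y y.2
  refine ⟨x, fun hneg => ?_, hasHalfLineDeriv_of_hasDerivWithinAt (v := X)
    (fun _ => rfl) fun y => ?_,
    (BoundedContinuousFunction.norm_le (by positivity)).2 fun y => hbound y y.2⟩
  · simp [x, X, hk hneg]
  · simpa using! (hX y).hasDerivWithinAt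

theorem eq_zero_of_hasHalfLineDeriv_mul {a : ℝ} {d : ℝ≥0 →ᵇ ℝ} (ha : a ≠ 0)
    (h0 : a < 0 → d 0 = 0) (hd : HasHalfLineDeriv d fun y => a * d y) : d = 0 := by
  have hconst : ∀ y : ℝ≥0, d y * Real.exp (-a * y) = d 0 := fun y => by
    have hcont : ContinuousOn (fun y => extendHalfLine d y * Real.exp (-a * y)) (Icc 0 y) :=
      ((continuous_extendHalfLine d).mul (by fun_prop)).continuousOn
    have := constant_of_has_deriv_right_zero hcont (fun t ht => by
      lift t to ℝ≥0 using ht.1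
      refine (((hd t).mono (Ici_subset_Ici.2 t.2)).mul
        (hasDerivAt_exp_const_mul (-a) t).hasDerivWithinAt).congr_deriv ?_
      rw [extendHalfLine_coe]
      ring) y (right_mem_Icc.2 y.2)
    simpa using this
  have hinit : d 0 = 0 := by
    rcases ha.lt_or_gt with hneg | hpos
    · exact h0 hneg
    · have hexp : Tendsto (fun y : ℝ≥0 => Real.exp (-a * y)) atTop (𝓝 0) :=
        Real.tendsto_exp_atBot.comp
          (NNReal.tendsto_coe_atTop.2 tendsto_id |>.const_mul_atTop_of_neg (neg_lt_zero.2 hpos))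
      have hbounded : IsBoundedUnder (· ≤ ·) atTop (norm ∘ d) :=
        isBoundedUnder_of ⟨‖d‖, d.norm_coe_le_norm⟩
      exact tendsto_nhds_unique (tendsto_const_nhds.congr fun y => (hconst y).symm)
        (isBoundedUnder_le_mul_tendsto_zero hbounded hexp)
  ext y
  simpa [hinit, Real.exp_ne_zero] using hconst y

theorem eq_of_hasHalfLineDeriv_mul_add {a : ℝ} (ha : a ≠ 0) {x z h : ℝ≥0 →ᵇ ℝ}
    (h0 : a < 0 → x 0 = z 0) (hx : HasHalfLineDeriv x fun y => a * x y + h y)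
    (hz : HasHalfLineDeriv z fun y => a * z y + h y) : x = z := by
  refine sub_eq_zero.1 (eq_zero_of_hasHalfLineDeriv_mul ha
    (fun hneg => sub_eq_zero.2 (h0 hneg)) ((hx.sub hz).congr_deriv fun y => ?_))
  simp only [Pi.sub_apply, BoundedContinuousFunction.sub_apply]
  ring

theorem exists_scalarSolutionOperator {a : ℝ} (ha : a ≠ 0) :
    ∃ S : ℝ × (ℝ≥0 →ᵇ ℝ) →L[ℝ] (ℝ≥0 →ᵇ ℝ), ∀ c h x, S (c, h) = x ↔
      (a < 0 → x 0 = c) ∧ HasHalfLineDeriv x fun y => a * x y + h y := by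
  choose S hS0 hSd hSn using exists_bounded_solution ha
  have huniq {c h x} (hx0 : a < 0 → x 0 = c) (hx : HasHalfLineDeriv x fun y => a * x y + h y) :
      S c h = x :=
    eq_of_hasHalfLineDeriv_mul_add ha (fun hneg => by rw [hS0 c h hneg, hx0 hneg]) (hSd c h) hx
  let T : ℝ × (ℝ≥0 →ᵇ ℝ) →ₗ[ℝ] (ℝ≥0 →ᵇ ℝ) :=
    { toFun := fun z => S z.1 z.2
      map_add' := fun y z => huniq
        (fun hneg => by simp [hS0 _ _ hneg])
        (((hSd y.1 y.2).add (hSd z.1 z.2)).congr_deriv fun t => by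
          simp only [Pi.add_apply, Prod.snd_add, BoundedContinuousFunction.add_apply]; ring)
      map_smul' := fun r z => huniq
        (fun hneg => by simp [hS0 _ _ hneg])
        (((hSd z.1 z.2).const_smul r).congr_deriv fun t => by
          simp only [Pi.smul_apply, Prod.smul_snd, BoundedContinuousFunction.smul_apply,
            smul_eq_mul, RingHom.id_apply]
          ring) }
  refine ⟨T.mkContinuous (1 + |a|⁻¹) fun z => (hSn z.1 z.2).trans ?_, fun c h x =>
    ⟨fun hx => hx ▸ ⟨hS0 c h, hSd c h⟩, fun hx => huniq hx.1 hx.2⟩⟩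
  rw [add_mul, one_mul]
  gcongr
  · exact norm_fst_le z
  · exact norm_snd_le z

end ScalarEquation

section DiagonalSystem

variable {ι : Type*} {E : Type*} [NormedAddCommGroup E] [NormedSpace ℝ E]

theorem repr_diagonal {b : Module.Basis ι ℝ E} {L : E →L[ℝ] E} {a : ι → ℝ}
    (hL : ∀ j, L (b j) = a j • b j) (x : E) (j : ι) : b.repr (L x) j = a j * b.repr x j := by
  have hcoord : b.coord j ∘ₗ L.toLinearMap = a j • b.coord j := b.ext fun i => by
    rcases eq_or_ne i j with rfl | hij <;> simp [*]
  exact LinearMap.congr_fun hcoord x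

variable [FiniteDimensional ℝ E]

/-- The coordinate functionals of a basis, as continuous linear maps. -/
noncomputable def coordCLM (b : Module.Basis ι ℝ E) (j : ι) : E →L[ℝ] ℝ :=
  LinearMap.toContinuousLinearMap (b.coord j)

@[simp]
theorem coordCLM_apply (b : Module.Basis ι ℝ E) (j : ι) (x : E) : coordCLM b j x = b.repr x j := rfl

/-- The coordinates of an `E`-valued function with respect to a basis. -/
noncomputable def coordFun (b : Module.Basis ι ℝ E) (j : ι) : (ℝ≥0 →ᵇ E) →L[ℝ] (ℝ≥0 →ᵇ ℝ) :=
  (coordCLM b j).compLeftContinuousBounded ℝ≥0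

@[simp]
theorem coordFun_apply (b : Module.Basis ι ℝ E) (j : ι) (ζ : ℝ≥0 →ᵇ E) (y : ℝ≥0) :
    coordFun b j ζ y = b.repr (ζ y) j := rfl

theorem eq_iff_coordFun_eq (b : Module.Basis ι ℝ E) {ζ ξ : ℝ≥0 →ᵇ E} :
    ζ = ξ ↔ ∀ j, coordFun b j ζ = coordFun b j ξ :=
  ⟨fun h _ => h ▸ rfl, fun h => BoundedContinuousFunction.ext fun y =>
    b.ext_elem fun j => DFunLike.congr_fun (h j) y⟩

theorem hasHalfLineDeriv_iff_coordFun (b : Module.Basis ι ℝ E) {ζ : ℝ≥0 →ᵇ E} {ζ' : ℝ≥0 → E} :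
    HasHalfLineDeriv ζ ζ' ↔
      ∀ j, HasHalfLineDeriv (coordFun b j ζ) fun y => b.repr (ζ' y) j := by
  have := FiniteDimensional.fintypeBasisIndex b
  unfold HasHalfLineDeriv
  rw [forall_comm]
  refine forall_congr' fun y => ?_
  rw [← hasDerivWithinAt_pi (φ := fun t j => extendHalfLine (coordFun b j ζ) t)
    (φ' := fun j => b.repr (ζ' y) j)]
  exact (b.equivFunL.comp_hasFDerivWithinAt_iff (f := extendHalfLine ζ)
    (f' := ContinuousLinearMap.toSpanSingleton ℝ (ζ' y))).symm.trans (by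
      rw [hasDerivWithinAt_iff_hasFDerivWithinAt]
      congr!
      ext j
      simp)

theorem exists_diagonalSolutionOperator (b : Module.Basis ι ℝ E) {a : ι → ℝ}
    (ha : ∀ j, a j ≠ 0) {L : E →L[ℝ] E} (hL : ∀ j, L (b j) = a j • b j) :
    ∃ S : E × (ℝ≥0 →ᵇ E) →L[ℝ] (ℝ≥0 →ᵇ E), ∀ ξ h ζ, S (ξ, h) = ζ ↔
      (∀ j, a j < 0 → b.repr (ζ 0) j = b.repr ξ j) ∧
        HasHalfLineDeriv ζ fun y => L (ζ y) + h y := by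
  have := FiniteDimensional.fintypeBasisIndex b
  choose R hR using fun j => exists_scalarSolutionOperator (ha j)
  let S : E × (ℝ≥0 →ᵇ E) →L[ℝ] (ℝ≥0 →ᵇ E) :=
    ∑ j, (ContinuousLinearMap.toSpanSingleton ℝ (b j)).compLeftContinuousBounded ℝ≥0 ∘L
      R j ∘L (coordCLM b j).prodMap (coordFun b j)
  have hS : ∀ ξ h j, coordFun b j (S (ξ, h)) = R j (b.repr ξ j, coordFun b j h) := fun ξ h j => by
    classical
    ext y
    simp [S, Finsupp.single_apply]
  refine ⟨S, fun ξ h ζ => ?_⟩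
  rw [eq_iff_coordFun_eq b, hasHalfLineDeriv_iff_coordFun b, ← forall_and]
  refine forall_congr' fun j => ?_
  simp only [hS, hR, coordFun_apply, map_add, Finsupp.add_apply, repr_diagonal hL]

theorem repr_eq_zero_of_hasHalfLineDeriv_diagonal {b : Module.Basis ι ℝ E} {a : ι → ℝ}
    {L : E →L[ℝ] E} (hL : ∀ j, L (b j) = a j • b j) {ζ : ℝ≥0 →ᵇ E}
    (hζ : HasHalfLineDeriv ζ fun y => L (ζ y)) {j : ι} (hj : 0 < a j) (y : ℝ≥0) :
    b.repr (ζ y) j = 0 := by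
  have hzero : coordFun b j ζ = 0 := eq_zero_of_hasHalfLineDeriv_mul hj.ne'
    (fun hneg => absurd hneg hj.not_gt)
    (((hasHalfLineDeriv_iff_coordFun b).1 hζ j).congr_deriv fun y => repr_diagonal hL (ζ y) j)
  exact DFunLike.congr_fun hzero y

end DiagonalSystem

theorem exists_implicit_solution {E G H : Type*} [NormedAddCommGroup E] [NormedSpace ℝ E]
    [CompleteSpace E] [NormedAddCommGroup G] [NormedSpace ℝ G] [CompleteSpace G]
    [NormedAddCommGroup H] [NormedSpace ℝ H] (S : E × H →L[ℝ] G) {M : E × G → H} {u : E}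
    (hM : ContDiffAt ℝ 1 M (u, 0)) (hMu : M (u, 0) = 0)
    (hM' : HasFDerivAt M (0 : E × G →L[ℝ] H) (u, 0)) :
    ∃ Z : E → G, Z u = 0 ∧ ContDiffAt ℝ 1 Z u ∧ HasFDerivAt Z (-(S ∘L .inl ℝ E H)) u ∧
      ∀ᶠ z in 𝓝 (u, 0), Z z.1 = z.2 ↔ S (u - z.1, M z) = z.2 := by
  let Ψ : E × G → G := fun z => z.2 - S (u - z.1, M z)
  have hΨ : ContDiffAt ℝ 1 Ψ (u, 0) :=
    contDiffAt_snd.sub (S.contDiff.contDiffAt.comp _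
      ((contDiffAt_const.sub contDiffAt_fst).prodMk hM))
  have hΨ' : HasFDerivAt Ψ (.snd ℝ E G + S ∘L .inl ℝ E H ∘L .fst ℝ E G) (u, 0) := by
    refine (hasFDerivAt_snd.sub (S.hasFDerivAt.comp (u, (0 : G))
      ((hasFDerivAt_fst.const_sub u).prodMk hM'))).congr_fderiv ?_
    ext x <;> simp [← map_neg, Prod.mk_zero_zero]
  have hΨu : Ψ (u, 0) = 0 := by simp [Ψ, hMu, ← Prod.zero_eq_mk]
  have hinr : fderiv ℝ Ψ (u, 0) ∘L .inr ℝ E G = .id ℝ G := by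
    rw [hΨ'.fderiv]; ext; simp [Prod.mk_zero_zero]
  have hinl : fderiv ℝ Ψ (u, 0) ∘L .inl ℝ E G = S ∘L .inl ℝ E H := by
    rw [hΨ'.fderiv]; ext; simp
  have hinv : (fderiv ℝ Ψ (u, 0) ∘L .inr ℝ E G).IsInvertible :=
    hinr ▸ ⟨ContinuousLinearEquiv.refl ℝ G, rfl⟩
  refine ⟨hΨ.implicitFunction one_ne_zero hinv, hΨ.implicitFunction_apply_self one_ne_zero hinv,
    hΨ.contDiffAt_implicitFunction one_ne_zero hinv, ?_, ?_⟩
  · have := (hΨ.hasStrictFDerivAt_implicitFunction one_ne_zero hinv).hasFDerivAt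
    rwa [hinl, hinr, ContinuousLinearMap.inverse_id, ContinuousLinearMap.id_comp] at this
  · filter_upwards [hΨ.eventually_apply_eq_iff_implicitFunction one_ne_zero hinv] with z hz
    rw [← hz, hΨu, sub_eq_zero, eq_comm]

section RescaledProfiles

variable {E : Type*} [NormedAddCommGroup E] [NormedSpace ℝ E]

/-- Multiplication by `e^{-ηy}`. -/
noncomputable def expDamp (E : Type*) [NormedAddCommGroup E] [NormedSpace ℝ E] {η : ℝ}
    (hη : 0 ≤ η) : (ℝ≥0 →ᵇ E) →L[ℝ] (ℝ≥0 →ᵇ E) :=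
  pointwiseApply ℝ≥0 E E <| BoundedContinuousFunction.ofNormedAddCommGroup
    (fun y : ℝ≥0 => Real.exp (-η * y) • ContinuousLinearMap.id ℝ E) (by fun_prop)
    ‖ContinuousLinearMap.id ℝ E‖ fun y => by
      rw [norm_smul, Real.norm_of_nonneg (Real.exp_pos _).le]
      refine mul_le_of_le_one_left (norm_nonneg _) (Real.exp_le_one_iff.2 ?_)
      exact mul_nonpos_of_nonpos_of_nonneg (neg_nonpos.2 hη) y.2

@[simp]
theorem expDamp_apply {η : ℝ} (hη : 0 ≤ η) (ζ : ℝ≥0 →ᵇ E) (y : ℝ≥0) :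
    expDamp E hη ζ y = Real.exp (-η * y) • ζ y := rfl

theorem tendsto_expDamp_atTop {η : ℝ} (hη : 0 < η) (ζ : ℝ≥0 →ᵇ E) :
    Tendsto (expDamp E hη.le ζ) atTop (𝓝 0) := by
  have hexp : Tendsto (fun y : ℝ≥0 => Real.exp (-η * y)) atTop (𝓝 0) :=
    Real.tendsto_exp_atBot.comp
      (NNReal.tendsto_coe_atTop.2 tendsto_id |>.const_mul_atTop_of_neg (neg_lt_zero.2 hη))
  exact NormedField.tendsto_zero_smul_of_tendsto_zero_of_bounded hexp
    (isBoundedUnder_of ⟨‖ζ‖, ζ.norm_coe_le_norm⟩)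

theorem HasHalfLineDeriv.damp {η : ℝ} (hη : 0 ≤ η) {ζ : ℝ≥0 →ᵇ E} {ζ' : ℝ≥0 → E}
    (hζ : HasHalfLineDeriv ζ ζ') :
    HasHalfLineDeriv (expDamp E hη ζ) fun y => Real.exp (-η * y) • (ζ' y - η • ζ y) :=
  hasHalfLineDeriv_of_hasDerivWithinAt (v := fun y => Real.exp (-η * y) • extendHalfLine ζ y)
    (fun y => by simp) fun y => by
      refine ((hasDerivAt_exp_const_mul (-η) y).hasDerivWithinAt.smul (hζ y)).congr_deriv ?_
      rw [extendHalfLine_coe]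
      module

/-- `ζ` is bounded and `v(y) = w + e^{-ηy} ζ(y)` solves `v' = Q(v, w) (v - w)`. -/
def IsRescaledProfile (Q : E × E → (E →L[ℝ] E)) (η : ℝ) (w : E) (ζ : ℝ≥0 →ᵇ E) : Prop :=
  HasHalfLineDeriv ζ fun y => Q (w + Real.exp (-η * y) • ζ y, w) (ζ y) + η • ζ y

theorem IsRescaledProfile.damp {Q : E × E → (E →L[ℝ] E)} {η : ℝ} (hη : 0 ≤ η) {w : E}
    {ζ : ℝ≥0 →ᵇ E} (hζ : IsRescaledProfile Q η w ζ) :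
    IsRescaledProfile Q 0 w (expDamp E hη ζ) :=
  (HasHalfLineDeriv.damp hη hζ).congr_deriv fun y => by simp

/-- The family `y ↦ (w + e^{-ηy} ζ(y), w)`, as a continuous linear function of `(w, ζ)`. -/
noncomputable def weightedShift (E : Type*) [NormedAddCommGroup E] [NormedSpace ℝ E] {η : ℝ}
    (hη : 0 ≤ η) : E × (ℝ≥0 →ᵇ E) →L[ℝ] (ℝ≥0 →ᵇ E × E) :=
  (constCLM ℝ≥0 (E × E) ∘L (.prod (.id ℝ E) (.id ℝ E))).coprod
    ((ContinuousLinearMap.inl ℝ E E).compLeftContinuousBounded ℝ≥0 ∘L expDamp E hη)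

theorem weightedShift_apply {η : ℝ} (hη : 0 ≤ η) (w : E) (ζ : ℝ≥0 →ᵇ E) (y : ℝ≥0) :
    weightedShift E hη (w, ζ) y = (w + Real.exp (-η * y) • ζ y, w) := by
  simp [weightedShift]

variable {ι : Type*}

/-- A `C¹` family `w ↦ Z w` that, near `(u, 0)`, consists of the rescaled profiles with limit state
`w` whose coordinates at time `0` along the directions `b j` with `μ j + η < 0` are those of
`u - w`. -/
structure IsRescaledProfileFamily (b : Module.Basis ι ℝ E) (μ : ι → ℝ) (η : ℝ)
    (Q : E × E → (E →L[ℝ] E)) (u : E) (Z : E → (ℝ≥0 →ᵇ E)) : Prop where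
  map_self : Z u = 0
  contDiffAt : ContDiffAt ℝ 1 Z u
  repr_fderiv : ∀ j, 0 < μ j + η → ∀ ξ, b.repr (fderiv ℝ Z u ξ 0) j = 0
  eventually_eq_iff : ∀ᶠ z in 𝓝 (u, 0), Z z.1 = z.2 ↔
    (∀ j, μ j + η < 0 → b.repr (z.2 0) j = b.repr (u - z.1) j) ∧ IsRescaledProfile Q η z.1 z.2

namespace IsRescaledProfileFamily

variable {b : Module.Basis ι ℝ E} {μ : ι → ℝ} {η : ℝ} {Q : E × E → (E →L[ℝ] E)} {u : E}
  {Z : E → (ℝ≥0 →ᵇ E)}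

theorem eventually_isRescaledProfile (hZ : IsRescaledProfileFamily b μ η Q u Z) :
    ∀ᶠ w in 𝓝 u, (∀ j, μ j + η < 0 → b.repr (Z w 0) j = b.repr (u - w) j) ∧
      IsRescaledProfile Q η w (Z w) := by
  have hpair : Tendsto (fun w => (w, Z w)) (𝓝 u) (𝓝 (u, 0)) :=
    hZ.map_self ▸ (continuousAt_id.prodMk hZ.contDiffAt.continuousAt : ContinuousAt _ u)
  filter_upwards [hpair.eventually hZ.eventually_eq_iff] with w hw using hw.1 rfl

theorem tendsto_expDamp (hZ : IsRescaledProfileFamily b μ η Q u Z) (hη : 0 ≤ η) :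
    Tendsto (fun w => expDamp E hη (Z w)) (𝓝 u) (𝓝 0) := by
  have hcont : ContinuousAt (fun w => expDamp E hη (Z w)) u :=
    (expDamp E hη).continuous.continuousAt.comp hZ.contDiffAt.continuousAt
  simpa [ContinuousAt, hZ.map_self] using hcont

theorem eventually_expDamp_eq {Z₀ : E → (ℝ≥0 →ᵇ E)} (hZ : IsRescaledProfileFamily b μ η Q u Z)
    (hZ₀ : IsRescaledProfileFamily b μ 0 Q u Z₀) (hη : 0 ≤ η)
    (hμη : ∀ j, μ j < 0 → μ j + η < 0) :
    ∀ᶠ w in 𝓝 u, Z₀ w = expDamp E hη (Z w) := by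
  have hpair : Tendsto (fun w => (w, expDamp E hη (Z w))) (𝓝 u) (𝓝 (u, 0)) :=
    tendsto_id.prodMk_nhds (hZ.tendsto_expDamp hη)
  filter_upwards [hpair.eventually hZ₀.eventually_eq_iff, hZ.eventually_isRescaledProfile]
    with w hw hZw
  exact hw.2 ⟨fun j hj => by simpa using hZw.1 j (hμη j (by simpa using hj)), hZw.2.damp hη⟩

end IsRescaledProfileFamily

section Remainder

variable [ProperSpace E]

/-- The nonlinear part `(Q(w + e^{-ηy} ζ, w) - Q(u, u)) ζ` of the equation for rescaled profiles,
as a function of `(w, ζ)`. -/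
noncomputable def rescaledRemainder {η : ℝ} (hη : 0 ≤ η) {Q : E × E → (E →L[ℝ] E)}
    (hQ : Continuous Q) (u : E) (z : E × (ℝ≥0 →ᵇ E)) : ℝ≥0 →ᵇ E :=
  pointwiseApply ℝ≥0 E E
    (superposition Q hQ (weightedShift E hη z) - constCLM ℝ≥0 (E →L[ℝ] E) (Q (u, u))) z.2

theorem rescaledRemainder_apply {η : ℝ} (hη : 0 ≤ η) {Q : E × E → (E →L[ℝ] E)}
    (hQ : Continuous Q) (u w : E) (ζ : ℝ≥0 →ᵇ E) (y : ℝ≥0) :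
    rescaledRemainder hη hQ u (w, ζ) y =
      Q (w + Real.exp (-η * y) • ζ y, w) (ζ y) - Q (u, u) (ζ y) := by
  simp [rescaledRemainder, weightedShift_apply]

theorem contDiff_rescaledRemainder {η : ℝ} (hη : 0 ≤ η) {Q : E × E → (E →L[ℝ] E)}
    (hQ : ContDiff ℝ 1 Q) (u : E) : ContDiff ℝ 1 (rescaledRemainder hη hQ.continuous u) := by
  have hcoefficient := ((contDiff_superposition hQ).comp (weightedShift E hη).contDiff).sub
    (contDiff_const (c := constCLM ℝ≥0 (E →L[ℝ] E) (Q (u, u))))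
  exact ((pointwiseApply ℝ≥0 E E).contDiff.comp hcoefficient).clm_apply contDiff_snd

theorem hasFDerivAt_rescaledRemainder {η : ℝ} (hη : 0 ≤ η) {Q : E × E → (E →L[ℝ] E)}
    (hQ : ContDiff ℝ 1 Q) (u : E) :
    HasFDerivAt (rescaledRemainder hη hQ.continuous u)
      (0 : E × (ℝ≥0 →ᵇ E) →L[ℝ] (ℝ≥0 →ᵇ E)) (u, 0) := by
  have hcoefficient := (((contDiff_superposition hQ).comp (weightedShift E hη).contDiff).sub
    (contDiff_const (c := constCLM ℝ≥0 (E →L[ℝ] E) (Q (u, u))))).differentiable one_ne_zero (u, 0)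
  refine ((pointwiseApply ℝ≥0 E E).hasFDerivAt_of_bilinear hcoefficient.hasFDerivAt
    (hasFDerivAt_snd (𝕜 := ℝ))).congr_fderiv ?_
  ext z y
  · simp
  · simp [weightedShift_apply]

theorem isRescaledProfile_iff {η : ℝ} (hη : 0 ≤ η) {Q : E × E → (E →L[ℝ] E)} (hQ : Continuous Q)
    (u : E) {w : E} {ζ : ℝ≥0 →ᵇ E} :
    IsRescaledProfile Q η w ζ ↔ HasHalfLineDeriv ζ fun y =>
      (Q (u, u) + η • .id ℝ E) (ζ y) + rescaledRemainder hη hQ u (w, ζ) y := by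
  refine forall_congr' fun y => ?_
  beta_reduce
  rw [rescaledRemainder_apply, add_apply, smul_apply, ContinuousLinearMap.id_apply,
    add_comm (Q (u, u) (ζ y)), add_add_sub_cancel, add_comm]

end Remainder

theorem exists_isRescaledProfileFamily [FiniteDimensional ℝ E] (b : Module.Basis ι ℝ E)
    {μ : ι → ℝ} {η : ℝ} (hη : 0 ≤ η)
    (hμη : ∀ j, μ j + η ≠ 0) {Q : E × E → (E →L[ℝ] E)} (hQ : ContDiff ℝ 1 Q) {u : E}
    (hQu : ∀ j, Q (u, u) (b j) = μ j • b j) :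
    ∃ Z, IsRescaledProfileFamily b μ η Q u Z := by
  have : ProperSpace E := FiniteDimensional.proper_real E
  have hdiagonal : ∀ j, (Q (u, u) + η • .id ℝ E) (b j) = (μ j + η) • b j := fun j => by
    simp [hQu, add_smul]
  obtain ⟨S, hS⟩ := exists_diagonalSolutionOperator b hμη hdiagonal
  have hremainder : rescaledRemainder hη hQ.continuous u (u, 0) = 0 := by
    ext y
    simp [rescaledRemainder_apply]
  obtain ⟨Z, hZu, hZ, hZ', hZeq⟩ := exists_implicit_solution S
    (contDiff_rescaledRemainder hη hQ u).contDiffAt hremainder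
    (hasFDerivAt_rescaledRemainder hη hQ u)
  refine ⟨Z, hZu, hZ, fun j hj ξ => ?_, ?_⟩
  · have hSξ := ((hS ξ 0 _).1 rfl).2.congr_deriv fun y => add_zero _
    have hunstable := repr_eq_zero_of_hasHalfLineDeriv_diagonal hdiagonal hSξ hj 0
    rw [hZ'.fderiv]
    simp [hunstable]
  · filter_upwards [hZeq] with z hz
    rw [hz, hS, ← isRescaledProfile_iff]

end RescaledProfiles

section Straightening

variable {ι E : Type*} [NormedAddCommGroup E] [NormedSpace ℝ E]

/-- `v` solves `v' = Q(v, w) (v - w)` on the half line, starts at `u` and converges to `w`. -/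
structure IsProfile (Q : E × E → (E →L[ℝ] E)) (u w : E) (v : ℝ → E) : Prop where
  hasDerivWithinAt : ∀ y, 0 ≤ y → HasDerivWithinAt v (Q (v y, w) (v y - w)) (Ici 0) y
  initial : v 0 = u
  tendsto : Tendsto v atTop (𝓝 w)

theorem IsRescaledProfile.isProfile {Q : E × E → (E →L[ℝ] E)} {η : ℝ} (hη : 0 < η) {u w : E}
    {ζ : ℝ≥0 →ᵇ E} (hζ : IsRescaledProfile Q η w ζ) (hζ₀ : ζ 0 = u - w) :
    IsProfile Q u w fun y => w + extendHalfLine (expDamp E hη.le ζ) y where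
  hasDerivWithinAt y hy := by
    lift y to ℝ≥0 using hy
    simpa using (hζ.damp hη.le y).const_add w
  initial := by simp [hζ₀]
  tendsto := by
    have hlim := ((tendsto_expDamp_atTop hη ζ).comp tendsto_real_toNNReal_atTop).const_add w
    rwa [add_zero] at hlim

theorem IsProfile.exists_isRescaledProfile {Q : E × E → (E →L[ℝ] E)} {u w : E} {v : ℝ → E}
    (hv : IsProfile Q u w v) {C : ℝ} (hC : ∀ y, 0 ≤ y → ‖v y - w‖ ≤ C) :
    ∃ ζ, IsRescaledProfile Q 0 w ζ ∧ ζ 0 = u - w ∧ ‖ζ‖ ≤ C := by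
  have hcont : ContinuousOn v (Ici 0) := fun y hy =>
    (hv.hasDerivWithinAt y hy).continuousWithinAt
  have hζcont : Continuous fun y : ℝ≥0 => v y - w :=
    (hcont.comp_continuous NNReal.continuous_coe fun y => y.2).sub continuous_const
  refine ⟨.ofNormedAddCommGroup _ hζcont C fun y => hC y y.2,
    hasHalfLineDeriv_of_hasDerivWithinAt (v := fun y => v y - w) (fun y => rfl) fun y => ?_, ?_, ?_⟩
  · simpa using (hv.hasDerivWithinAt y y.2).sub_const w
  · simp [hv.initial]
  · exact BoundedContinuousFunction.norm_ofNormedAddCommGroup_le _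
      ((norm_nonneg _).trans (hC 0 le_rfl)) _

/-- The span of the basis vectors `b j` with `μ j < 0`; for eigenvalues `μ` this is the stable
subspace of the linear system. -/
def stableSubspace (b : Module.Basis ι ℝ E) (μ : ι → ℝ) : Submodule ℝ E :=
  Submodule.span ℝ (b '' {j | μ j < 0})

theorem mem_stableSubspace_iff {b : Module.Basis ι ℝ E} {μ : ι → ℝ} {x : E} :
    x ∈ stableSubspace b μ ↔ ∀ j, 0 ≤ μ j → b.repr x j = 0 := by
  rw [stableSubspace, b.mem_span_image]
  refine forall_congr' fun j => ?_
  simp only [Finset.mem_coe, Finsupp.mem_support_iff, mem_ofPred_eq]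
  rw [← not_lt, not_imp_comm]

/-- `θ` is a `C¹` chart centred at `u` whose derivative at `u` is the identity. -/
structure IsTangentChartAt (θ : E → E) (u : E) : Prop where
  contDiffAt : ContDiffAt ℝ 1 θ u
  hasFDerivAt : HasFDerivAt θ (.id ℝ E) u
  map_self : θ u = 0

variable [FiniteDimensional ℝ E]

/-- The coordinate projection that kills the basis vectors `b j` with `μ j < 0`. -/
noncomputable def unstableProjection (b : Module.Basis ι ℝ E) (μ : ι → ℝ) : E →L[ℝ] E :=
  LinearMap.toContinuousLinearMap (b.constr ℝ fun j => (if μ j < 0 then 0 else 1 : ℝ) • b j)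

theorem repr_unstableProjection (b : Module.Basis ι ℝ E) (μ : ι → ℝ) (x : E) (j : ι) :
    b.repr (unstableProjection b μ x) j = (if μ j < 0 then 0 else 1) * b.repr x j := by
  refine repr_diagonal (a := fun i => if μ i < 0 then 0 else 1) (fun i => ?_) x j
  simp [unstableProjection]

/-- A chart at `u` that sends the limit states `w` with `Z w 0 = u - w` to the stable subspace,
when `Z` is a family of rescaled profiles. -/
noncomputable def straighteningMap (b : Module.Basis ι ℝ E) (μ : ι → ℝ) (u : E)
    (Z : E → (ℝ≥0 →ᵇ E)) (w : E) : E :=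
  w - u + unstableProjection b μ (Z w 0)

theorem straighteningMap_mem_iff {b : Module.Basis ι ℝ E} {μ : ι → ℝ} {u w : E}
    {Z : E → (ℝ≥0 →ᵇ E)} : straighteningMap b μ u Z w ∈ stableSubspace b μ ↔
      ∀ j, 0 ≤ μ j → b.repr (Z w 0) j = b.repr (u - w) j := by
  rw [mem_stableSubspace_iff]
  refine forall₂_congr fun j hj => ?_
  rw [straighteningMap, map_add, Finsupp.add_apply, repr_unstableProjection, if_neg hj.not_gt,
    one_mul, ← neg_sub u w, map_neg, Finsupp.neg_apply, neg_add_eq_zero, eq_comm]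

theorem exists_pos_forall_add_neg [Finite ι] (μ : ι → ℝ) :
    ∃ η > 0, ∀ j, μ j < 0 → μ j + η < 0 := by
  have hsmall : ∀ᶠ η in 𝓝[>] (0 : ℝ), ∀ j, μ j < 0 → μ j + η < 0 :=
    eventually_all.2 fun j => eventually_imp_distrib_left.2 fun hj =>
      (eventually_lt_nhds (neg_pos.2 hj)).filter_mono nhdsWithin_le_nhds |>.mono fun η hη => by
        linarith
  exact (eventually_mem_nhdsWithin.and hsmall).exists

namespace IsRescaledProfileFamily

variable {b : Module.Basis ι ℝ E} {μ : ι → ℝ} {η : ℝ} {Q : E × E → (E →L[ℝ] E)} {u : E}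
  {Z : E → (ℝ≥0 →ᵇ E)}

theorem isTangentChartAt (hZ : IsRescaledProfileFamily b μ η Q u Z) (hη : 0 < η) :
    IsTangentChartAt (straighteningMap b μ u Z) u := by
  let evalZero := unstableProjection b μ ∘L BoundedContinuousFunction.evalCLM ℝ (0 : ℝ≥0)
  have hcorrection : evalZero ∘L fderiv ℝ Z u = 0 := by
    ext ξ
    refine b.ext_elem fun j => (repr_unstableProjection b μ _ j).trans ?_
    rcases lt_or_ge (μ j) 0 with hj | hj
    · simp [hj]
    · have hvanish : b.repr (fderiv ℝ Z u ξ 0) j = 0 := hZ.repr_fderiv j (by positivity) ξ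
      simp [hvanish]
  exact {
    contDiffAt := (contDiffAt_id.sub contDiffAt_const).add
      (evalZero.contDiff.contDiffAt.comp u hZ.contDiffAt)
    hasFDerivAt := (((hasFDerivAt_id u).sub_const u).add (evalZero.hasFDerivAt.comp u
      (hZ.contDiffAt.differentiableAt one_ne_zero).hasFDerivAt)).congr_fderiv (by
        rw [hcorrection, add_zero])
    map_self := by simp [straighteningMap, hZ.map_self] }

theorem eventually_exists_isProfile (hZ : IsRescaledProfileFamily b μ η Q u Z) (hη : 0 < η)
    (hμη : ∀ j, μ j < 0 → μ j + η < 0) {r : ℝ} (hr : 0 < r) :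
    ∀ᶠ w in 𝓝 u, straighteningMap b μ u Z w ∈ stableSubspace b μ →
      ∃ v, IsProfile Q u w v ∧ ∀ y, 0 ≤ y → v y ∈ Metric.ball u r := by
  have hsmall : ∀ᶠ w in 𝓝 u, dist w u + ‖expDamp E hη.le (Z w)‖ < r := by
    have hlim := (tendsto_id.dist (tendsto_const_nhds (x := u))).add (hZ.tendsto_expDamp hη.le).norm
    exact hlim.eventually_lt_const (by simpa using hr)
  filter_upwards [hZ.eventually_isRescaledProfile, hsmall] with w ⟨hstable, hode⟩ hwr hθ
  have hinitial : Z w 0 = u - w := b.ext_elem fun j => by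
    rcases lt_or_ge (μ j) 0 with hj | hj
    · exact hstable j (hμη j hj)
    · exact straighteningMap_mem_iff.1 hθ j hj
  refine ⟨_, hode.isProfile hη hinitial, fun y _ => ?_⟩
  calc dist (w + extendHalfLine (expDamp E hη.le (Z w)) y) u
      ≤ dist w u + ‖extendHalfLine (expDamp E hη.le (Z w)) y‖ := by
        rw [dist_eq_norm, dist_eq_norm, add_sub_right_comm]
        exact norm_add_le _ _
    _ ≤ dist w u + ‖expDamp E hη.le (Z w)‖ := by gcongr; exact norm_extendHalfLine_le _ y
    _ < r := hwr

theorem exists_forall_isProfile_mem {Z₀ : E → (ℝ≥0 →ᵇ E)}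
    (hZ : IsRescaledProfileFamily b μ η Q u Z) (hZ₀ : IsRescaledProfileFamily b μ 0 Q u Z₀)
    (hη : 0 ≤ η) (hμη : ∀ j, μ j < 0 → μ j + η < 0) :
    ∃ ρ > 0, ∀ᶠ w in 𝓝 u, ∀ v, IsProfile Q u w v → (∀ y, 0 ≤ y → v y ∈ Metric.ball u ρ) →
      straighteningMap b μ u Z w ∈ stableSubspace b μ := by
  obtain ⟨ε, hε, hunique⟩ := Metric.eventually_nhds_iff_ball.1 hZ₀.eventually_eq_iff
  refine ⟨ε / 4, by positivity, ?_⟩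
  filter_upwards [hZ.eventually_expDamp_eq hZ₀ hη hμη,
    Metric.ball_mem_nhds u (show 0 < ε / 4 by positivity)] with w hdamp hwu v hv hball
  obtain ⟨ζ, hζ, hζ₀, hζε⟩ := hv.exists_isRescaledProfile (C := ε / 2) fun y hy => by
    rw [← dist_eq_norm]
    linarith [dist_triangle_right (v y) w u, Metric.mem_ball.1 (hball y hy), Metric.mem_ball.1 hwu]
  have hnear : (w, ζ) ∈ Metric.ball (u, (0 : ℝ≥0 →ᵇ E)) ε := by
    rw [Metric.mem_ball, Prod.dist_eq, dist_zero_right]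
    exact max_lt (by linarith [Metric.mem_ball.1 hwu]) (by linarith)
  have hZ₀w : Z₀ w = ζ := (hunique _ hnear).2 ⟨fun j _ => by rw [hζ₀], hζ⟩
  have hinitial : Z w 0 = u - w := by
    rw [← hζ₀, ← hZ₀w, hdamp]
    simp
  exact straighteningMap_mem_iff.2 fun j _ => by rw [hinitial]

end IsRescaledProfileFamily

theorem exists_straightening (b : Module.Basis ι ℝ E) {μ : ι → ℝ} {Q : E × E → (E →L[ℝ] E)}
    (hQ : ContDiff ℝ 1 Q) {u : E} (hQu : ∀ j, Q (u, u) (b j) = μ j • b j) :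
    ∃ θ : E → E, IsTangentChartAt θ u ∧
      (∀ r > 0, ∀ᶠ w in 𝓝 u, θ w ∈ stableSubspace b μ →
        ∃ v, IsProfile Q u w v ∧ ∀ y, 0 ≤ y → v y ∈ Metric.ball u r) ∧
      ((∀ j, μ j ≠ 0) → ∃ ρ > 0, ∀ᶠ w in 𝓝 u, ∀ v, IsProfile Q u w v →
        (∀ y, 0 ≤ y → v y ∈ Metric.ball u ρ) → θ w ∈ stableSubspace b μ) := by
  have := FiniteDimensional.fintypeBasisIndex b
  obtain ⟨η, hη, hμη⟩ := exists_pos_forall_add_neg μ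
  have hne : ∀ j, μ j + η ≠ 0 := fun j =>
    (lt_or_ge (μ j) 0).elim (fun hj => (hμη j hj).ne) fun hj => by positivity
  obtain ⟨Z, hZ⟩ := exists_isRescaledProfileFamily b hη.le hne hQ hQu
  refine ⟨_, hZ.isTangentChartAt hη, fun r => hZ.eventually_exists_isProfile hη hμη,
    fun hμ => ?_⟩
  obtain ⟨Z₀, hZ₀⟩ := exists_isRescaledProfileFamily b le_rfl (by simpa using hμ) hQ hQu
  exact hZ.exists_forall_isProfile_mem hZ₀ hη.le hμη

end Straightening

section Submanifold

theorem mem_submodule_of_hasDerivAt {E : Type*} [NormedAddCommGroup E] [NormedSpace ℝ E]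
    [FiniteDimensional ℝ E] {L : Submodule ℝ E} {g : ℝ → E} {g' : E} {t : ℝ}
    (hg : HasDerivAt g g' t) (hL : ∀ᶠ s in 𝓝 t, g s ∈ L) : g' ∈ L := by
  refine L.closed_of_finiteDimensional.mem_of_tendsto (hasDerivAt_iff_tendsto_slope.1 hg) ?_
  filter_upwards [hL.filter_mono nhdsWithin_le_nhds] with s hs
  exact L.smul_mem _ (L.sub_mem hs hL.self_of_nhds)

theorem IsTangentChartAt.exists_openPartialHomeomorph {E : Type*} [NormedAddCommGroup E]
    [NormedSpace ℝ E] [CompleteSpace E] {θ : E → E} {x : E} (hθ : IsTangentChartAt θ x)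
    {P : E → Prop} (hP : ∀ᶠ w in 𝓝 x, P w) :
    ∃ Φ : OpenPartialHomeomorph E E, ⇑Φ = θ ∧ x ∈ Φ.source ∧ (∀ z ∈ Φ.source, P z) ∧
      ContDiffOn ℝ 1 Φ Φ.source ∧ ContDiffOn ℝ 1 Φ.symm Φ.target := by
  have hequiv : HasFDerivAt θ (ContinuousLinearEquiv.refl ℝ E : E →L[ℝ] E) x := hθ.hasFDerivAt
  let Φ₀ := hθ.contDiffAt.toOpenPartialHomeomorph θ hequiv one_ne_zero
  have hsymm : ∀ᶠ z in 𝓝 (θ x), ContDiffAt ℝ 1 Φ₀.symm z :=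
    (hθ.contDiffAt.to_localInverse hequiv one_ne_zero).eventually (by simp)
  obtain ⟨O, hO, hOopen, hxO⟩ := eventually_nhds_iff.1
    ((hθ.contDiffAt.eventually (by simp)).and
      ((hθ.contDiffAt.continuousAt.eventually hsymm).and hP))
  let Φ := Φ₀.restrOpen O hOopen
  have hsource : Φ.source = Φ₀.source ∩ O := Φ₀.restrOpen_source O hOopen
  have hΦO : ∀ z ∈ Φ.source, z ∈ O := fun z hz => (hsource ▸ hz).2
  refine ⟨Φ, rfl, hsource ▸ ⟨hθ.contDiffAt.mem_toOpenPartialHomeomorph_source hequiv one_ne_zero,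
    hxO⟩, fun z hz => (hO z (hΦO z hz)).2.2,
    fun z hz => (hO z (hΦO z hz)).1.contDiffWithinAt, fun z hz => ?_⟩
  have hpreimage : ContDiffAt ℝ 1 Φ₀.symm (Φ (Φ.symm z)) :=
    (hO _ (hΦO _ (Φ.map_target hz))).2.1
  rw [Φ.right_inv hz] at hpreimage
  exact hpreimage.contDiffWithinAt

variable {N : ℕ}

theorem tangentVectors_subset_of_hasFDerivAt {M : Set (EuclideanSpace ℝ (Fin N))}
    {L : Submodule ℝ (EuclideanSpace ℝ (Fin N))} {x : EuclideanSpace ℝ (Fin N)}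
    {θ : EuclideanSpace ℝ (Fin N) → EuclideanSpace ℝ (Fin N)}
    (hθ : HasFDerivAt θ (.id ℝ _) x) (hM : ∀ w ∈ M, θ w ∈ L) : tangentVectors M x ⊆ L := by
  rintro h ⟨γ, hγ, rfl, rfl, hmem⟩
  exact mem_submodule_of_hasDerivAt
    (hθ.comp_hasDerivAt 0 (hγ.differentiableAt one_ne_zero).hasDerivAt)
    (hmem.mono fun t ht => hM _ ht)

theorem subset_tangentVectors_of_hasFDerivAt {M : Set (EuclideanSpace ℝ (Fin N))}
    {L : Submodule ℝ (EuclideanSpace ℝ (Fin N))}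
    {ψ : EuclideanSpace ℝ (Fin N) → EuclideanSpace ℝ (Fin N)} (hψ : ContDiffAt ℝ 1 ψ 0)
    (hψ' : HasFDerivAt ψ (.id ℝ _) 0) (hM : ∀ᶠ z in 𝓝 0, z ∈ L → ψ z ∈ M) :
    (L : Set (EuclideanSpace ℝ (Fin N))) ⊆ tangentVectors M (ψ 0) := by
  intro h hh
  have hline : HasDerivAt (fun t : ℝ => t • h) h 0 := by
    simpa using (hasDerivAt_id (0 : ℝ)).smul_const h
  have hline₀ : (0 : ℝ) • h = 0 := zero_smul ℝ h
  refine ⟨fun t => ψ (t • h), ?_, congrArg ψ hline₀, ?_, ?_⟩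
  · exact ContDiffAt.comp (0 : ℝ) (g := ψ) (hline₀ ▸ hψ) (by fun_prop)
  · exact (HasFDerivAt.comp_hasDerivAt (l := ψ) 0 (hline₀.symm ▸ hψ') hline).deriv
  · have htendsto : Tendsto (fun t : ℝ => t • h) (𝓝 0) (𝓝 0) := by
      simpa using hline.continuousAt.tendsto
    filter_upwards [htendsto.eventually hM] with t ht using ht (L.smul_mem t hh)

theorem IsTangentChartAt.isLocallySubmanifoldAt {S : Set (EuclideanSpace ℝ (Fin N))}
    {x : EuclideanSpace ℝ (Fin N)} {L : Submodule ℝ (EuclideanSpace ℝ (Fin N))}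
    {θ : EuclideanSpace ℝ (Fin N) → EuclideanSpace ℝ (Fin N)} (hθ : IsTangentChartAt θ x)
    (hS : ∀ᶠ w in 𝓝 x, w ∈ S ↔ θ w ∈ L) :
    IsLocallySubmanifoldAt (Module.finrank ℝ L) S x L := by
  obtain ⟨Φ, rfl, hx, hΦS, hΦ, hΦsymm⟩ := hθ.exists_openPartialHomeomorph hS
  have hzero : 0 ∈ Φ.target := hθ.map_self ▸ Φ.map_source hx
  have hsymm_zero : Φ.symm 0 = x := hθ.map_self ▸ Φ.left_inv hx
  have hmem : ∀ z ∈ Φ.source, z ∈ S ∩ Φ.source ↔ Φ z ∈ L := fun z hz =>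
    (and_iff_left hz).trans (hΦS z hz)
  refine ⟨Φ.source, Φ.open_source, hx, (hΦS x hx).2 (hθ.map_self ▸ L.zero_mem),
    fun y hy => ⟨Φ, L, hy.2, hΦ, hΦsymm, rfl, hmem⟩, Subset.antisymm ?_ ?_⟩
  · exact tangentVectors_subset_of_hasFDerivAt hθ.hasFDerivAt fun w hw => (hmem w hw.2).1 hw
  · have hsymm_deriv : HasFDerivAt Φ.symm (.id ℝ _) 0 :=
      Φ.hasFDerivAt_symm (f' := ContinuousLinearEquiv.refl ℝ _) hzero
        (by rw [hsymm_zero]; exact hθ.hasFDerivAt)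
    have hL : ∀ᶠ z in 𝓝 0, z ∈ L → Φ.symm z ∈ S ∩ Φ.source := by
      filter_upwards [Φ.open_target.mem_nhds hzero] with z hz hzL
      exact (hmem _ (Φ.map_target hz)).2 (by rwa [Φ.right_inv hz])
    have hsubset := subset_tangentVectors_of_hasFDerivAt
      (hΦsymm.contDiffAt (Φ.open_target.mem_nhds hzero)) hsymm_deriv hL
    rwa [hsymm_zero] at hsubset

end Submanifold

section Entropy

theorem exists_eventually_mul_sq_norm_le {X E : Type*} [TopologicalSpace X] [NormedAddCommGroup E]
    [NormedSpace ℝ E] [ProperSpace E] {q : X → E → ℝ} {x₀ : X}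
    (hq : ∀ h, ContinuousAt (Function.uncurry q) (x₀, h))
    (hsmul : ∀ x (t : ℝ) h, q x (t • h) = t ^ 2 * q x h) (hpos : ∀ h, h ≠ 0 → 0 < q x₀ h) :
    ∃ c > 0, ∀ᶠ x in 𝓝 x₀, ∀ h, c * ‖h‖ ^ 2 ≤ q x h := by
  have hsphere : IsCompact (Metric.sphere (0 : E) 1) := isCompact_sphere 0 1
  have hq₀ : Continuous (q x₀) := continuous_iff_continuousAt.2 fun h =>
    (hq h).comp (continuousAt_const.prodMk continuousAt_id)
  obtain ⟨m, hm, hmin⟩ := hsphere.exists_forall_le' hq₀.continuousOn (a := 0) fun h hh =>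
    hpos h (ne_zero_of_mem_unit_sphere ⟨h, hh⟩)
  have hnear : ∀ᶠ x in 𝓝 x₀, ∀ h ∈ Metric.sphere (0 : E) 1, m / 2 < q x h :=
    hsphere.eventually_forall_of_forall_eventually fun h hh =>
      (hq h).eventually_const_lt ((half_lt_self hm).trans_le (hmin h hh))
  refine ⟨m / 2, half_pos hm, hnear.mono fun x hx h => ?_⟩
  rcases eq_or_ne h 0 with rfl | hh
  · simpa using (hsmul x 0 0).ge
  · have hunit : ‖h‖⁻¹ • h ∈ Metric.sphere (0 : E) 1 := by simp [norm_smul, hh]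
    have hnorm : ‖h‖ • ‖h‖⁻¹ • h = h := smul_inv_smul₀ (norm_ne_zero_iff.2 hh) h
    rw [← hnorm, hsmul, hnorm, mul_comm]
    exact mul_le_mul_of_nonneg_left (hx _ hunit).le (sq_nonneg _)

theorem forall_mem_of_forall_Ico_mem {X : Type*} [TopologicalSpace X] {O : Set X} (hO : IsOpen O)
    {v : ℝ → X} (hv : ContinuousOn v (Ici 0))
    (hstep : ∀ T, 0 ≤ T → (∀ y ∈ Ico 0 T, v y ∈ O) → v T ∈ O) : ∀ y, 0 ≤ y → v y ∈ O := by
  by_contra! hexit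
  let A := Ici 0 ∩ v ⁻¹' Oᶜ
  have hA : A.Nonempty := hexit
  have hAbdd : BddBelow A := ⟨0, fun y hy => hy.1⟩
  have hAclosed : IsClosed A :=
    hv.preimage_isClosed_of_isClosed isClosed_Ici hO.isClosed_compl
  obtain ⟨hT, hTO⟩ := hAclosed.csInf_mem hA hAbdd
  exact hTO <| hstep _ hT fun y hy => not_not.1 fun hyO =>
    (csInf_le hAbdd ⟨hy.1, hyO⟩).not_gt hy.2

variable {N : ℕ} {𝒰 : Set (EuclideanSpace ℝ (Fin N))}
  {f : EuclideanSpace ℝ (Fin N) → EuclideanSpace ℝ (Fin N)}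
  {B : EuclideanSpace ℝ (Fin N) → EuclideanSpace ℝ (Fin N) →L[ℝ] EuclideanSpace ℝ (Fin N)}
  {U F : EuclideanSpace ℝ (Fin N) → ℝ} {u w : EuclideanSpace ℝ (Fin N)}
  {v : ℝ → EuclideanSpace ℝ (Fin N)}

/-- `v` is a smooth solution in `𝒰` of the boundary-layer problem with boundary state `u` and
limit state `w`, as in `viscousLayerSet`. -/
structure IsViscousProfile (𝒰 : Set (EuclideanSpace ℝ (Fin N)))
    (f : EuclideanSpace ℝ (Fin N) → EuclideanSpace ℝ (Fin N))
    (B : EuclideanSpace ℝ (Fin N) → EuclideanSpace ℝ (Fin N) →L[ℝ] EuclideanSpace ℝ (Fin N))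
    (u w : EuclideanSpace ℝ (Fin N)) (v : ℝ → EuclideanSpace ℝ (Fin N)) : Prop where
  contDiffOn : ContDiffOn ℝ ∞ v (Ici 0)
  mem : ∀ y, 0 ≤ y → v y ∈ 𝒰
  ode : ∀ y, 0 ≤ y → B (v y) (derivWithin v (Ici 0) y) = f (v y) - f w
  initial : v 0 = u
  tendsto : Tendsto v atTop (𝓝 w)

theorem mem_viscousLayerSet_iff :
    w ∈ viscousLayerSet 𝒰 f B u ↔ w ∈ 𝒰 ∧ ∃ v, IsViscousProfile 𝒰 f B u w v :=
  and_congr_right fun _ => exists_congr fun _ =>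
    ⟨fun ⟨h₁, h₂, h₃, h₄, h₅⟩ => ⟨h₁, h₂, h₃, h₄, h₅⟩,
      fun ⟨h₁, h₂, h₃, h₄, h₅⟩ => ⟨h₁, h₂, h₃, h₄, h₅⟩⟩

theorem IsViscousProfile.hasDerivWithinAt (hv : IsViscousProfile 𝒰 f B u w v) {y : ℝ}
    (hy : 0 ≤ y) : HasDerivWithinAt v (derivWithin v (Ici 0) y) (Ici 0) y :=
  (hv.contDiffOn.differentiableOn (by simp) y hy).hasDerivWithinAt

/-- The entropy excess of the state `v` over the limit state `w`; it dissipates along profiles. -/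
noncomputable def entropyExcess (f : EuclideanSpace ℝ (Fin N) → EuclideanSpace ℝ (Fin N))
    (U F : EuclideanSpace ℝ (Fin N) → ℝ) (w v : EuclideanSpace ℝ (Fin N)) : ℝ :=
  F v - F w - fderiv ℝ U v (f v - f w)

@[simp]
theorem entropyExcess_self (w : EuclideanSpace ℝ (Fin N)) : entropyExcess f U F w w = 0 := by
  simp [entropyExcess]

namespace IsBConvexEntropyPair

theorem contDiffOn_fderiv (hUF : IsBConvexEntropyPair 𝒰 f B U F) (h𝒰 : IsOpen 𝒰) :
    ContDiffOn ℝ 1 (fderiv ℝ U) 𝒰 :=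
  hUF.1.fderiv_of_isOpen h𝒰 (by norm_num [one_add_one_eq_two])

theorem hasDerivWithinAt_entropyExcess (hUF : IsBConvexEntropyPair 𝒰 f B U F) (h𝒰 : IsOpen 𝒰)
    (hf : ContDiffOn ℝ 1 f 𝒰) {d : EuclideanSpace ℝ (Fin N)} {s : Set ℝ} {y : ℝ}
    (hv : HasDerivWithinAt v d s y) (hvy : v y ∈ 𝒰) (hode : B (v y) d = f (v y) - f w) :
    HasDerivWithinAt (fun y => entropyExcess f U F w (v y))
      (-fderiv ℝ (fderiv ℝ U) (v y) d (B (v y) d)) s y := by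
  have hdiff {G : Type} [NormedAddCommGroup G] [NormedSpace ℝ G]
      {g : EuclideanSpace ℝ (Fin N) → G} (hg : ContDiffOn ℝ 1 g 𝒰) :
      HasDerivWithinAt (g ∘ v) (fderiv ℝ g (v y) d) s y :=
    ((hg.contDiffAt (h𝒰.mem_nhds hvy)).differentiableAt
      one_ne_zero).hasFDerivAt.comp_hasDerivWithinAt y hv
  refine (((hdiff (hUF.2.1.of_le one_le_two)).sub_const (F w)).sub
    ((hdiff (hUF.contDiffOn_fderiv h𝒰)).clm_apply ((hdiff hf).sub_const (f w)))).congr_deriv ?_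
  rw [hUF.2.2.1 _ hvy, hode]
  simp

theorem continuousAt_entropyExcess (hUF : IsBConvexEntropyPair 𝒰 f B U F) (h𝒰 : IsOpen 𝒰)
    (hf : ContinuousOn f 𝒰) (hw : w ∈ 𝒰) (hu : u ∈ 𝒰) :
    ContinuousAt (Function.uncurry (entropyExcess f U F)) (w, u) := by
  have hfst {G : Type} [TopologicalSpace G] {g : EuclideanSpace ℝ (Fin N) → G}
      (hg : ContinuousOn g 𝒰) : ContinuousAt (fun z => g z.1) (w, u) :=
    ContinuousAt.comp (hg.continuousAt (h𝒰.mem_nhds hw)) continuousAt_fst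
  have hsnd {G : Type} [TopologicalSpace G] {g : EuclideanSpace ℝ (Fin N) → G}
      (hg : ContinuousOn g 𝒰) : ContinuousAt (fun z => g z.2) (w, u) :=
    ContinuousAt.comp (hg.continuousAt (h𝒰.mem_nhds hu)) continuousAt_snd
  exact ((hsnd hUF.2.1.continuousOn).sub (hfst hUF.2.1.continuousOn)).sub
    ((hsnd (hUF.contDiffOn_fderiv h𝒰).continuousOn).clm_apply ((hsnd hf).sub (hfst hf)))

theorem dissipation_nonneg (hUF : IsBConvexEntropyPair 𝒰 f B U F) (hu : u ∈ 𝒰)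
    (h : EuclideanSpace ℝ (Fin N)) : 0 ≤ fderiv ℝ (fderiv ℝ U) u h (B u h) := by
  rcases eq_or_ne h 0 with rfl | hne
  · simp
  · exact (hUF.2.2.2 u hu h hne).le

theorem exists_eventually_coercive (hUF : IsBConvexEntropyPair 𝒰 f B U F) (h𝒰 : IsOpen 𝒰)
    (hB : ContinuousOn B 𝒰) (hu : u ∈ 𝒰) :
    ∃ c > 0, ∀ᶠ x in 𝓝 u, ∀ h, c * ‖h‖ ^ 2 ≤ fderiv ℝ (fderiv ℝ U) x h (B x h) := by
  have hhessian : ContinuousAt (fderiv ℝ (fderiv ℝ U)) u :=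
    (((hUF.contDiffOn_fderiv h𝒰).continuousOn_fderiv_of_isOpen h𝒰 le_rfl).continuousAt
      (h𝒰.mem_nhds hu))
  have hBu : ContinuousAt B u := hB.continuousAt (h𝒰.mem_nhds hu)
  refine exists_eventually_mul_sq_norm_le (q := fun x h => fderiv ℝ (fderiv ℝ U) x h (B x h))
    (fun h => ?_) (fun x t h => ?_) (hUF.2.2.2 u hu)
  · have hfst : Tendsto Prod.fst (𝓝 (u, h)) (𝓝 u) := continuousAt_fst
    exact ((ContinuousAt.comp (x := (u, h)) hhessian hfst).clm_apply continuousAt_snd).clm_apply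
      ((ContinuousAt.comp (x := (u, h)) hBu hfst).clm_apply continuousAt_snd)
  · simp only [map_smul, smul_apply, smul_eq_mul]
    ring

theorem exists_eventually_le_dissipation (hUF : IsBConvexEntropyPair 𝒰 f B U F) (h𝒰 : IsOpen 𝒰)
    (hf : ContDiffOn ℝ 1 f 𝒰) (hB : ContinuousOn B 𝒰) (hu : u ∈ 𝒰)
    (hinj : Function.Injective (fderiv ℝ f u)) :
    ∃ κ > 0, ∀ᶠ z in 𝓝 (u, u), ∀ d, B z.1 d = f z.1 - f z.2 →
      2 * κ * (‖z.1 - z.2‖ * ‖d‖) ≤ fderiv ℝ (fderiv ℝ U) z.1 d (B z.1 d) := by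
  obtain ⟨c, hc, hcoercive⟩ := hUF.exists_eventually_coercive h𝒰 hB hu
  have hstrict : HasStrictFDerivAt f (fderiv ℝ f u) u :=
    (hf.contDiffAt (h𝒰.mem_nhds hu)).hasStrictFDerivAt one_ne_zero
  have hinducing : IsInducing (fderiv ℝ f u) :=
    (LinearMap.isClosedEmbedding_of_injective (f := (fderiv ℝ f u).toLinearMap)
      (LinearMap.ker_eq_bot.2 hinj)).isInducing
  obtain ⟨K, hK, hexpand⟩ := (hstrict.isTheta_sub hinducing).2.exists_pos
  let C := ‖B u‖ + 1
  have hBC : ∀ᶠ x in 𝓝 u, ‖B x‖ ≤ C :=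
    (hB.continuousAt (h𝒰.mem_nhds hu)).norm.eventually_le_const (lt_add_one _)
  have hfst : Tendsto Prod.fst (𝓝 (u, u)) (𝓝 u) := continuousAt_fst
  have hC : 0 < C := by positivity
  refine ⟨c / (2 * (K * C)), by positivity, ?_⟩
  filter_upwards [hfst.eventually hcoercive, hfst.eventually hBC, hexpand.bound]
    with z hzc hzC hzK d hd
  have hdist : ‖z.1 - z.2‖ ≤ K * C * ‖d‖ :=
    calc ‖z.1 - z.2‖ ≤ K * ‖B z.1 d‖ := hd ▸ hzK
      _ ≤ K * (C * ‖d‖) := by gcongr; exact (B z.1).le_of_opNorm_le hzC d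
      _ = K * C * ‖d‖ := (mul_assoc ..).symm
  calc 2 * (c / (2 * (K * C))) * (‖z.1 - z.2‖ * ‖d‖)
      ≤ 2 * (c / (2 * (K * C))) * (K * C * ‖d‖ * ‖d‖) := by gcongr
    _ = c * ‖d‖ ^ 2 := by field_simp
    _ ≤ fderiv ℝ (fderiv ℝ U) z.1 d (B z.1 d) := hzc d

end IsBConvexEntropyPair

namespace IsViscousProfile

theorem antitoneOn_entropyExcess_add (hv : IsViscousProfile 𝒰 f B u w v) (h𝒰 : IsOpen 𝒰)
    (hf : ContDiffOn ℝ 1 f 𝒰) (hUF : IsBConvexEntropyPair 𝒰 f B U F) {κ : ℝ} (hκ : 0 ≤ κ)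
    {s : Set ℝ} (hs : Convex ℝ s) (hs₀ : s ⊆ Ici 0)
    (hdiss : ∀ y ∈ interior s, 2 * κ * (‖v y - w‖ * ‖derivWithin v (Ici 0) y‖) ≤
      fderiv ℝ (fderiv ℝ U) (v y) (derivWithin v (Ici 0) y)
        (B (v y) (derivWithin v (Ici 0) y))) :
    AntitoneOn (fun y => entropyExcess f U F w (v y) + κ * ‖v y - w‖ ^ 2) s := by
  have hderiv : ∀ y ∈ s, HasDerivWithinAt
      (fun y => entropyExcess f U F w (v y) + κ * ‖v y - w‖ ^ 2)
      (-fderiv ℝ (fderiv ℝ U) (v y) (derivWithin v (Ici 0) y)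
        (B (v y) (derivWithin v (Ici 0) y)) +
          κ * (2 * inner ℝ (v y - w) (derivWithin v (Ici 0) y))) s y := fun y hy => by
    have hvy := (hv.hasDerivWithinAt (hs₀ hy)).mono hs₀
    exact (hUF.hasDerivWithinAt_entropyExcess h𝒰 hf hvy (hv.mem y (hs₀ hy))
      (hv.ode y (hs₀ hy))).add ((hvy.sub_const w).norm_sq.const_mul κ)
  refine antitoneOn_of_hasDerivWithinAt_nonpos hs (fun y hy => (hderiv y hy).continuousWithinAt)
    (fun y hy => (hderiv y (interior_subset hy)).mono interior_subset) fun y hy => ?_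
  have hinner : κ * (2 * inner ℝ (v y - w) (derivWithin v (Ici 0) y)) ≤
      2 * κ * (‖v y - w‖ * ‖derivWithin v (Ici 0) y‖) := by
    rw [mul_left_comm, mul_assoc]
    gcongr
    exact real_inner_le_norm _ _
  linarith [hdiss y hy]

theorem entropyExcess_nonneg (hv : IsViscousProfile 𝒰 f B u w v) (h𝒰 : IsOpen 𝒰)
    (hf : ContDiffOn ℝ 1 f 𝒰) (hUF : IsBConvexEntropyPair 𝒰 f B U F) (hw : w ∈ 𝒰) {y : ℝ}
    (hy : 0 ≤ y) : 0 ≤ entropyExcess f U F w (v y) := by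
  have hanti : AntitoneOn (fun y => entropyExcess f U F w (v y)) (Ici 0) := by
    simpa using hv.antitoneOn_entropyExcess_add h𝒰 hf hUF le_rfl (convex_Ici 0) Subset.rfl
      fun y hy => by simpa using hUF.dissipation_nonneg (hv.mem y (interior_subset hy)) _
  have hlim : Tendsto (fun y => entropyExcess f U F w (v y)) atTop (𝓝 0) := by
    have hcont := (hUF.continuousAt_entropyExcess h𝒰 hf.continuousOn hw hw).tendsto.comp
      (tendsto_const_nhds.prodMk_nhds hv.tendsto)
    simpa [Function.comp_def] using hcont
  exact le_of_tendsto hlim ((eventually_ge_atTop y).mono fun t ht => hanti hy (hy.trans ht) ht)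

end IsViscousProfile

theorem IsBConvexEntropyPair.eventually_isViscousProfile_mem_ball
    (hUF : IsBConvexEntropyPair 𝒰 f B U F) (h𝒰 : IsOpen 𝒰) (hf : ContDiffOn ℝ 1 f 𝒰)
    (hB : ContinuousOn B 𝒰) (hu : u ∈ 𝒰) (hinj : Function.Injective (fderiv ℝ f u)) {ρ : ℝ}
    (hρ : 0 < ρ) :
    ∀ᶠ w in 𝓝 u, ∀ v, IsViscousProfile 𝒰 f B u w v → ∀ y, 0 ≤ y → v y ∈ Metric.ball u ρ := by
  obtain ⟨κ, hκ, hdiss⟩ := hUF.exists_eventually_le_dissipation h𝒰 hf hB hu hinj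
  obtain ⟨ε, hε, hdissε⟩ := Metric.eventually_nhds_iff_ball.1 hdiss
  let r := min ρ ε
  have hr : 0 < r := lt_min hρ hε
  have hsmall : ∀ᶠ w in 𝓝 u, entropyExcess f U F w u + κ * ‖u - w‖ ^ 2 < κ * (r / 2) ^ 2 := by
    have hexcess : ContinuousAt (fun w => entropyExcess f U F w u) u :=
      ContinuousAt.comp (f := fun w => (w, u))
        (hUF.continuousAt_entropyExcess h𝒰 hf.continuousOn hu hu) (by fun_prop)
    have hcont : ContinuousAt (fun w => entropyExcess f U F w u + κ * ‖u - w‖ ^ 2) u :=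
      hexcess.add (by fun_prop)
    have hpos : 0 < κ * (r / 2) ^ 2 := by positivity
    exact hcont.eventually_lt_const (by simpa using hpos)
  filter_upwards [hsmall, Metric.ball_mem_nhds u (half_pos hr), h𝒰.mem_nhds hu]
    with w hw hwr hw𝒰 v hv y hy
  refine Metric.ball_subset_ball (min_le_left ρ ε) <| forall_mem_of_forall_Ico_mem
    (Metric.isOpen_ball (x := u) (ε := r)) hv.contDiffOn.continuousOn (fun T hT hbefore => ?_) y hy
  have hlyapunov := hv.antitoneOn_entropyExcess_add h𝒰 hf hUF hκ.le (convex_Icc 0 T)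
    Icc_subset_Ici_self (fun y hy => by
      rw [interior_Icc] at hy
      refine hdissε (v y, w) ?_ _ (hv.ode y hy.1.le)
      rw [← ball_prod_same]
      exact ⟨Metric.ball_subset_ball (min_le_right ρ ε) (hbefore y (Ioo_subset_Ico_self hy)),
        Metric.ball_subset_ball ((half_le_self hr.le).trans (min_le_right ρ ε)) hwr⟩)
    (left_mem_Icc.2 hT) (right_mem_Icc.2 hT) hT
  have hdistT : ‖v T - w‖ < r / 2 := by
    have hnonneg := hv.entropyExcess_nonneg h𝒰 hf hUF hw𝒰 hT
    simp only [hv.initial] at hlyapunov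
    refine lt_of_pow_lt_pow_left₀ 2 (by positivity) (lt_of_mul_lt_mul_left ?_ hκ.le)
    linarith
  calc dist (v T) u ≤ dist (v T) w + dist w u := dist_triangle _ _ _
    _ < r / 2 + r / 2 := add_lt_add (by rwa [dist_eq_norm]) hwr
    _ = r := add_halves r

end Entropy

section ProfileOperator

theorem contDiffOn_Ici_of_hasDerivWithinAt {E : Type*} [NormedAddCommGroup E] [NormedSpace ℝ E]
    {O : Set E} {G : E → E} (hG : ContDiffOn ℝ ∞ G O) {v : ℝ → E} (hv : ∀ y, 0 ≤ y → v y ∈ O)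
    (hder : ∀ y, 0 ≤ y → HasDerivWithinAt v (G (v y)) (Ici 0) y) :
    ContDiffOn ℝ ∞ v (Ici 0) := by
  rw [contDiffOn_infty]
  intro n
  induction n with
  | zero => exact contDiffOn_zero.2 fun y hy => (hder y hy).continuousWithinAt
  | succ n ih =>
    push_cast
    rw [contDiffOn_succ_iff_derivWithin (uniqueDiffOn_Ici 0)]
    refine ⟨fun y hy => (hder y hy).differentiableWithinAt, by simp, ?_⟩
    exact ((hG.of_le (by exact_mod_cast le_top)).comp ih hv).congr fun y hy =>
      (hder y hy).derivWithin (uniqueDiffOn_Ici 0 y hy)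

variable {E : Type*} [NormedAddCommGroup E] [NormedSpace ℝ E] {f : E → E} {B : E → E →L[ℝ] E}

theorem ringInverse_apply_eq_iff {L : E →L[ℝ] E} (hL : IsUnit L) {x y : E} :
    Ring.inverse L y = x ↔ L x = y := by
  obtain ⟨e, rfl⟩ := hL
  rw [Ring.inverse_unit, eq_comm (b := y)]
  exact inv_smul_eq_iff (g := e)

/-- On `O` the operator family `Q` turns the boundary-layer equation into the linear-looking
equation `v' = Q (v, w) (v - w)`. -/
structure IsProfileOperatorOn (f : E → E) (B : E → E →L[ℝ] E) (Q : E × E → (E →L[ℝ] E))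
    (O : Set E) : Prop where
  isUnit : ∀ v ∈ O, IsUnit (B v)
  apply_sub : ∀ v ∈ O, ∀ w ∈ O, Q (v, w) (v - w) = Ring.inverse (B v) (f v - f w)

theorem IsProfileOperatorOn.mono {Q : E × E → (E →L[ℝ] E)} {O O' : Set E}
    (hQ : IsProfileOperatorOn f B Q O) (hO' : O' ⊆ O) : IsProfileOperatorOn f B Q O' where
  isUnit v hv := hQ.isUnit v (hO' hv)
  apply_sub v hv w hw := hQ.apply_sub v (hO' hv) w (hO' hw)

theorem exists_isProfileOperatorOn [FiniteDimensional ℝ E] {u : E}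
    (hf : ContDiffAt ℝ 2 f u) (hB : ContDiffAt ℝ 1 B u) (hBu : IsUnit (B u)) :
    ∃ Q : E × E → (E →L[ℝ] E), ContDiff ℝ 1 Q ∧ Q (u, u) = Ring.inverse (B u) * fderiv ℝ f u ∧
      ∃ O ∈ 𝓝 u, IsProfileOperatorOn f B Q O := by
  have : CompleteSpace E := FiniteDimensional.complete ℝ E
  have : ProperSpace E := FiniteDimensional.proper_real E
  have hinv : ContDiffAt ℝ (1 : ℕ) (fun v => Ring.inverse (B v)) u := by
    obtain ⟨e, he⟩ := hBu
    exact ContDiffAt.comp u (he ▸ contDiffAt_ringInverse ℝ e) hB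
  obtain ⟨g, hg, hgf⟩ := exists_contDiff_eventuallyEq (n := 2) hf
  obtain ⟨R, hR, hRB⟩ := exists_contDiff_eventuallyEq hinv
  obtain ⟨q, hq, hqsub, hqu⟩ := exists_contDiff_factor hg
  have hunit : ∀ᶠ v in 𝓝 u, IsUnit (B v) :=
    hB.continuousAt.eventually (Units.isOpen.mem_nhds hBu)
  refine ⟨fun z => R z.1 * q z, (ContDiff.comp hR contDiff_fst).mul hq, ?_,
    _, hunit.and (hgf.and hRB), fun v hv => hv.1, fun v hv w hw => ?_⟩
  · simp only [hqu, hRB.self_of_nhds, hgf.fderiv_eq]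
  · simp only [mul_apply_eq_comp, hqsub, hv.2.1, hw.2.1, hv.2.2]

end ProfileOperator

theorem injective_of_basis_apply_eq_smul {ι E F : Type*} [AddCommGroup E] [Module ℝ E]
    [AddCommGroup F] [Module ℝ F] {A C : E →ₗ[ℝ] F} (hC : Function.Injective C)
    (b : Module.Basis ι ℝ E) {μ : ι → ℝ} (hμ : ∀ j, A (b j) = μ j • C (b j))
    (hμ₀ : ∀ j, μ j ≠ 0) : Function.Injective A := by
  have hindep : LinearIndependent ℝ fun j => A (b j) := by
    simp only [hμ]
    exact (b.linearIndependent.map' C (LinearMap.ker_eq_bot.2 hC)).units_smul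
      fun j => Units.mk0 (μ j) (hμ₀ j)
  simpa only [b.constr_self] using b.injective_constr_of_linearIndependent (R₂ := ℝ) hindep

theorem finrank_stableSubspace {E : Type*} [NormedAddCommGroup E] [NormedSpace ℝ E] {N p : ℕ}
    (b : Module.Basis (Fin N) ℝ E) {μ : Fin N → ℝ} (hp : p ≤ N)
    (hμ : ∀ j, μ j < 0 ↔ (j : ℕ) < p) : Module.finrank ℝ (stableSubspace b μ) = p := by
  classical
  have hindep : LinearIndependent ℝ fun j : {j | μ j < 0} => b j :=
    b.linearIndependent.comp _ Subtype.val_injective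
  rw [stableSubspace, image_eq_range, finrank_span_eq_card hindep]
  simp [hμ, Fintype.card_subtype, Fin.card_filter_val_lt, hp]

theorem exists_basis_of_common_eigenvectors {ι E : Type*} [Fintype ι] [NormedAddCommGroup E]
    [NormedSpace ℝ E] [FiniteDimensional ℝ E] (hcard : Fintype.card ι = Module.finrank ℝ E)
    {A C : E →L[ℝ] E} {r : ι → E} {lam : ι → ℝ} (hlam : Function.Injective lam)
    (hr₀ : ∀ j, r j ≠ 0) (hA : ∀ j, A (r j) = lam j • r j)
    (hC : ∀ j, ∃ β : ℝ, 0 < β ∧ C (r j) = β • r j) :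
    IsUnit C ∧ ∃ (b : Module.Basis ι ℝ E) (β : ι → ℝ), ⇑b = r ∧ (∀ j, 0 < β j) ∧
      ∀ j, A (b j) = (lam j / β j) • C (b j) := by
  have : CompleteSpace E := FiniteDimensional.complete ℝ E
  have hindep : LinearIndependent ℝ r :=
    Module.End.eigenvectors_linearIndependent' A.toLinearMap lam hlam r fun j =>
      ⟨Module.End.mem_eigenspace_iff.2 (hA j), hr₀ j⟩
  let b := basisOfLinearIndependentOfCardEqFinrank' r hindep hcard
  have hb : ⇑b = r := coe_basisOfLinearIndependentOfCardEqFinrank' ..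
  choose β hβ hCr using hC
  have hCb : ∀ j, C (b j) = β j • LinearMap.id (R := ℝ) (b j) := fun j => by simp [hb, hCr]
  have hinj : Function.Injective C := injective_of_basis_apply_eq_smul (A := C.toLinearMap)
    Function.injective_id b hCb fun j => (hβ j).ne'
  refine ⟨ContinuousLinearMap.isUnit_iff_bijective.2
    ⟨hinj, LinearMap.injective_iff_surjective (f := C.toLinearMap).1 hinj⟩, b, β, hb, hβ,
    fun j => ?_⟩
  rw [hb, hCr, hA, smul_smul, div_mul_cancel₀ _ (hβ j).ne']

section Layer

variable {N : ℕ} {𝒰 𝒱 : Set (EuclideanSpace ℝ (Fin N))}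
  {f : EuclideanSpace ℝ (Fin N) → EuclideanSpace ℝ (Fin N)}
  {B : EuclideanSpace ℝ (Fin N) → EuclideanSpace ℝ (Fin N) →L[ℝ] EuclideanSpace ℝ (Fin N)}
  {Q : EuclideanSpace ℝ (Fin N) × EuclideanSpace ℝ (Fin N) →
    (EuclideanSpace ℝ (Fin N) →L[ℝ] EuclideanSpace ℝ (Fin N))}
  {u w : EuclideanSpace ℝ (Fin N)} {v : ℝ → EuclideanSpace ℝ (Fin N)}

theorem self_mem_viscousLayerSet (hu : u ∈ 𝒰) : u ∈ viscousLayerSet 𝒰 f B u :=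
  ⟨hu, fun _ => u, contDiffOn_const, fun _ _ => hu, fun y _ => by simp, rfl, tendsto_const_nhds⟩

theorem viscousLayerSet_mono (h : 𝒱 ⊆ 𝒰) : viscousLayerSet 𝒱 f B u ⊆ viscousLayerSet 𝒰 f B u :=
  fun _ ⟨hw, v, hv, hmem, hv'⟩ => ⟨h hw, v, hv, fun y hy => h (hmem y hy), hv'⟩

theorem IsProfile.isViscousProfile (hv : IsProfile Q u w v) (hQ : IsProfileOperatorOn f B Q 𝒰)
    (hf : ContDiffOn ℝ ∞ f 𝒰) (hB : ContDiffOn ℝ ∞ B 𝒰) (hw : w ∈ 𝒰)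
    (hv𝒰 : ∀ y, 0 ≤ y → v y ∈ 𝒰) : IsViscousProfile 𝒰 f B u w v := by
  have hderiv : ∀ y, 0 ≤ y →
      HasDerivWithinAt v (Ring.inverse (B (v y)) (f (v y) - f w)) (Ici 0) y := fun y hy =>
    hQ.apply_sub _ (hv𝒰 y hy) _ hw ▸ hv.hasDerivWithinAt y hy
  have hfield : ContDiffOn ℝ ∞ (fun x => Ring.inverse (B x) (f x - f w)) 𝒰 := fun x hx => by
    have hinv : ContDiffAt ℝ ∞ Ring.inverse (B x) := by
      obtain ⟨e, he⟩ := hQ.isUnit x hx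
      exact he ▸ contDiffAt_ringInverse ℝ e
    exact (hinv.comp_contDiffWithinAt x (hB x hx)).clm_apply ((hf x hx).sub contDiffWithinAt_const)
  exact {
    contDiffOn := contDiffOn_Ici_of_hasDerivWithinAt hfield hv𝒰 hderiv
    mem := hv𝒰
    ode := fun y hy => by
      rw [(hderiv y hy).derivWithin (uniqueDiffOn_Ici 0 y hy)]
      exact (ringInverse_apply_eq_iff (hQ.isUnit _ (hv𝒰 y hy))).1 rfl
    initial := hv.initial
    tendsto := hv.tendsto }

theorem IsViscousProfile.isProfile (hv : IsViscousProfile 𝒰 f B u w v)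
    (hQ : IsProfileOperatorOn f B Q 𝒰) (hw : w ∈ 𝒰) : IsProfile Q u w v where
  hasDerivWithinAt y hy := by
    rw [hQ.apply_sub _ (hv.mem y hy) _ hw,
      (ringInverse_apply_eq_iff (hQ.isUnit _ (hv.mem y hy))).2 (hv.ode y hy)]
    exact hv.hasDerivWithinAt hy
  initial := hv.initial
  tendsto := hv.tendsto

variable {ι : Type*}

theorem exists_layer_straightening (h𝒰 : 𝒰 ∈ 𝓝 u) (hf : ContDiffOn ℝ ∞ f 𝒰)
    (hB : ContDiffOn ℝ ∞ B 𝒰) (hBu : IsUnit (B u))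
    (b : Module.Basis ι ℝ (EuclideanSpace ℝ (Fin N))) {μ : ι → ℝ}
    (hμ : ∀ j, fderiv ℝ f u (b j) = μ j • B u (b j)) :
    ∃ θ, IsTangentChartAt θ u ∧
      (∀ 𝒱 ∈ 𝓝 u, ∀ᶠ w in 𝓝 u, θ w ∈ stableSubspace b μ → w ∈ viscousLayerSet 𝒱 f B u) ∧
      ((∀ j, μ j ≠ 0) → ∃ ρ > 0, ∀ᶠ w in 𝓝 u,
        w ∈ viscousLayerSet (Metric.ball u ρ) f B u → θ w ∈ stableSubspace b μ) := by
  obtain ⟨Q, hQ, hQu, O, hO, hQO⟩ := exists_isProfileOperatorOn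
    ((contDiffOn_infty.1 hf 2).contDiffAt h𝒰) ((contDiffOn_infty.1 hB 1).contDiffAt h𝒰) hBu
  obtain ⟨θ, hθ, hexists, hunique⟩ := exists_straightening b hQ (u := u) fun j => by
    rw [hQu, mul_apply_eq_comp]
    exact (ringInverse_apply_eq_iff hBu).2 (by rw [map_smul, hμ])
  refine ⟨θ, hθ, fun 𝒱 h𝒱 => ?_, fun hμ₀ => ?_⟩
  · obtain ⟨r, hr, hball⟩ := Metric.mem_nhds_iff.1 (inter_mem h𝒱 (inter_mem hO h𝒰))
    filter_upwards [hexists r hr, Metric.ball_mem_nhds u hr] with w hw hwr hwθ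
    obtain ⟨v, hv, hvr⟩ := hw hwθ
    have hprofile := hv.isViscousProfile (hQO.mono fun x hx => (hball hx).2.1)
      (hf.mono fun x hx => (hball hx).2.2) (hB.mono fun x hx => (hball hx).2.2) hwr hvr
    exact viscousLayerSet_mono (fun x hx => (hball hx).1)
      (mem_viscousLayerSet_iff.2 ⟨hwr, v, hprofile⟩)
  · obtain ⟨ρ, hρ, hθρ⟩ := hunique hμ₀
    obtain ⟨r, hr, hball⟩ := Metric.mem_nhds_iff.1 (inter_mem hO (Metric.ball_mem_nhds u hρ))
    refine ⟨r, hr, hθρ.mono fun w hw hwr => ?_⟩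
    obtain ⟨hwr, v, hv⟩ := mem_viscousLayerSet_iff.1 hwr
    exact hw v (hv.isProfile (hQO.mono fun x hx => (hball hx).1) hwr) fun y hy =>
      (hball (hv.mem y hy)).2

theorem exists_isC1Submanifold_subset_viscousLayerSet (h𝒰 : 𝒰 ∈ 𝓝 u) (hf : ContDiffOn ℝ ∞ f 𝒰)
    (hB : ContDiffOn ℝ ∞ B 𝒰) (hBu : IsUnit (B u))
    (b : Module.Basis ι ℝ (EuclideanSpace ℝ (Fin N))) {μ : ι → ℝ}
    (hμ : ∀ j, fderiv ℝ f u (b j) = μ j • B u (b j)) :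
    ∃ M ⊆ viscousLayerSet 𝒰 f B u, u ∈ M ∧
      IsC1Submanifold (Module.finrank ℝ (stableSubspace b μ)) M ∧
      tangentVectors M u = stableSubspace b μ := by
  obtain ⟨θ, hθ, hexists, -⟩ := exists_layer_straightening h𝒰 hf hB hBu b hμ
  let S := viscousLayerSet 𝒰 f B u ∩ {w | θ w ∈ stableSubspace b μ}
  have hS : ∀ᶠ w in 𝓝 u, w ∈ S ↔ θ w ∈ stableSubspace b μ :=
    (hexists 𝒰 h𝒰).mono fun w hw => ⟨And.right, fun h => ⟨hw h, h⟩⟩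
  obtain ⟨W, -, huW, huS, hSW, htangent⟩ := hθ.isLocallySubmanifoldAt hS
  exact ⟨S ∩ W, fun w hw => hw.1.1, ⟨huS, huW⟩, hSW, htangent⟩

theorem exists_forall_isLocallySubmanifoldAt_viscousLayerSet (h𝒰 : 𝒰 ∈ 𝓝 u)
    (hf : ContDiffOn ℝ ∞ f 𝒰) (hB : ContDiffOn ℝ ∞ B 𝒰) (hBu : IsUnit (B u))
    (b : Module.Basis ι ℝ (EuclideanSpace ℝ (Fin N))) {μ : ι → ℝ}
    (hμ : ∀ j, fderiv ℝ f u (b j) = μ j • B u (b j)) (hμ₀ : ∀ j, μ j ≠ 0) :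
    ∃ ρ > 0, ∀ 𝒱 ∈ 𝓝 u, (∀ᶠ w in 𝓝 u,
        w ∈ viscousLayerSet 𝒱 f B u → w ∈ viscousLayerSet (Metric.ball u ρ) f B u) →
      IsLocallySubmanifoldAt (Module.finrank ℝ (stableSubspace b μ)) (viscousLayerSet 𝒱 f B u) u
        (stableSubspace b μ) := by
  obtain ⟨θ, hθ, hexists, hunique⟩ := exists_layer_straightening h𝒰 hf hB hBu b hμ
  obtain ⟨ρ, hρ, hθρ⟩ := hunique hμ₀
  refine ⟨ρ, hρ, fun 𝒱 h𝒱 hconfined => hθ.isLocallySubmanifoldAt ?_⟩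
  filter_upwards [hexists 𝒱 h𝒱, hconfined, hθρ] with w hw hwρ hwθ
  exact ⟨hwθ ∘ hwρ, hw⟩

theorem theorem3p4_general (h𝒰 : IsOpen 𝒰) (hf : ContDiffOn ℝ ∞ f 𝒰) (hB : ContDiffOn ℝ ∞ B 𝒰)
    (hu : u ∈ 𝒰) (hBu : IsUnit (B u)) (b : Module.Basis ι ℝ (EuclideanSpace ℝ (Fin N)))
    {μ : ι → ℝ} (hμ : ∀ j, fderiv ℝ f u (b j) = μ j • B u (b j)) :
    u ∈ viscousLayerSet 𝒰 f B u ∧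
    (∃ M ⊆ viscousLayerSet 𝒰 f B u, u ∈ M ∧
      IsC1Submanifold (Module.finrank ℝ (stableSubspace b μ)) M ∧
      tangentVectors M u = stableSubspace b μ) ∧
    ((∀ j, μ j ≠ 0) →
      ((∃ U F : EuclideanSpace ℝ (Fin N) → ℝ, IsBConvexEntropyPair 𝒰 f B U F) →
        IsLocallySubmanifoldAt (Module.finrank ℝ (stableSubspace b μ)) (viscousLayerSet 𝒰 f B u) u
          (stableSubspace b μ)) ∧
      (∃ 𝒰₀ : Set (EuclideanSpace ℝ (Fin N)), IsOpen 𝒰₀ ∧ u ∈ 𝒰₀ ∧ 𝒰₀ ⊆ 𝒰 ∧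
        ∀ 𝒱 : Set (EuclideanSpace ℝ (Fin N)), IsOpen 𝒱 → u ∈ 𝒱 → 𝒱 ⊆ 𝒰₀ →
          IsLocallySubmanifoldAt (Module.finrank ℝ (stableSubspace b μ))
            (viscousLayerSet 𝒱 f B u) u (stableSubspace b μ))) := by
  have h𝒰u : 𝒰 ∈ 𝓝 u := h𝒰.mem_nhds hu
  refine ⟨self_mem_viscousLayerSet hu,
    exists_isC1Submanifold_subset_viscousLayerSet h𝒰u hf hB hBu b hμ, fun hμ₀ => ?_⟩
  obtain ⟨ρ, hρ, hlocal⟩ :=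
    exists_forall_isLocallySubmanifoldAt_viscousLayerSet h𝒰u hf hB hBu b hμ hμ₀
  refine ⟨?_, Metric.ball u ρ ∩ 𝒰, Metric.isOpen_ball.inter h𝒰,
    ⟨Metric.mem_ball_self hρ, hu⟩, inter_subset_right, fun 𝒱 h𝒱 hu𝒱 h𝒱ρ =>
      hlocal 𝒱 (h𝒱.mem_nhds hu𝒱) <| Eventually.of_forall fun w hw =>
        viscousLayerSet_mono (h𝒱ρ.trans inter_subset_left) hw⟩
  rintro ⟨U, F, hUF⟩
  have hinj : Function.Injective (fderiv ℝ f u) :=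
    injective_of_basis_apply_eq_smul (ContinuousLinearMap.isUnit_iff_bijective.1 hBu).1 b hμ hμ₀
  refine hlocal 𝒰 h𝒰u ?_
  filter_upwards [hUF.eventually_isViscousProfile_mem_ball h𝒰 (hf.of_le (by exact_mod_cast le_top))
    hB.continuousOn hu hinj hρ, Metric.ball_mem_nhds u hρ] with w hconfined hwρ hw
  obtain ⟨-, v, hv⟩ := mem_viscousLayerSet_iff.1 hw
  exact mem_viscousLayerSet_iff.2 ⟨hwρ, v, { hv with mem := hconfined v hv }⟩

end Layer

theorem theorem3p4 {N : ℕ} (p : ℕ) (hp : p ≤ N)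
    (𝒰 : Set (EuclideanSpace ℝ (Fin N))) (h𝒰 : IsOpen 𝒰)
    (f : EuclideanSpace ℝ (Fin N) → EuclideanSpace ℝ (Fin N)) (hf : ContDiffOn ℝ ∞ f 𝒰)
    (B : EuclideanSpace ℝ (Fin N) → EuclideanSpace ℝ (Fin N) →L[ℝ] EuclideanSpace ℝ (Fin N))
    (hB : ContDiffOn ℝ ∞ B 𝒰)
    -- strict hyperbolicity: real distinct eigenvalues `lam 0 < lam 1 < ⋯` of `∇f`, eigenvectors `r j`
    (lam : Fin N → EuclideanSpace ℝ (Fin N) → ℝ)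
    (r : Fin N → EuclideanSpace ℝ (Fin N) → EuclideanSpace ℝ (Fin N))
    (hlam : ∀ u ∈ 𝒰, StrictMono fun j => lam j u)
    (hr0 : ∀ u ∈ 𝒰, ∀ j, r j u ≠ 0)
    (hr : ∀ u ∈ 𝒰, ∀ j, fderiv ℝ f u (r j u) = lam j u • r j u)
    (uB : EuclideanSpace ℝ (Fin N)) (huB : uB ∈ 𝒰)
    -- near `uB` the `r j` are eigenvectors of `B` with positive eigenvalues
    (hBr : ∀ᶠ u in 𝓝 uB, ∀ j, ∃ b : ℝ, 0 < b ∧ B u (r j u) = b • r j u)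
    -- near `uB` the first `p` eigenvalues are negative and the others nonnegative
    (hneg : ∀ᶠ u in 𝓝 uB, ∀ j : Fin N, (j : ℕ) < p → lam j u < 0)
    (hnonneg : ∀ᶠ u in 𝓝 uB, ∀ j : Fin N, p ≤ (j : ℕ) → 0 ≤ lam j u) :
    uB ∈ viscousLayerSet 𝒰 f B uB ∧
    (∃ M ⊆ viscousLayerSet 𝒰 f B uB, uB ∈ M ∧ IsC1Submanifold p M) ∧
    ((∀ j : Fin N, p ≤ (j : ℕ) → 0 < lam j uB) →
      -- the layer set itself, if some entropy pair on the state domain is `B`-convex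
      ((∃ U F : EuclideanSpace ℝ (Fin N) → ℝ, IsBConvexEntropyPair 𝒰 f B U F) →
        IsLocallySubmanifoldAt p (viscousLayerSet 𝒰 f B uB) uB
          (Submodule.span ℝ {w | ∃ j : Fin N, (j : ℕ) < p ∧ w = r j uB})) ∧
      -- without entropies: the layer set of every small enough state domain around `uB`
      (∃ 𝒰₀ : Set (EuclideanSpace ℝ (Fin N)), IsOpen 𝒰₀ ∧ uB ∈ 𝒰₀ ∧ 𝒰₀ ⊆ 𝒰 ∧
        ∀ 𝒱 : Set (EuclideanSpace ℝ (Fin N)), IsOpen 𝒱 → uB ∈ 𝒱 → 𝒱 ⊆ 𝒰₀ →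
          IsLocallySubmanifoldAt p (viscousLayerSet 𝒱 f B uB) uB
            (Submodule.span ℝ {w | ∃ j : Fin N, (j : ℕ) < p ∧ w = r j uB}))) := by
  have hsign : ∀ j, lam j uB < 0 ↔ (j : ℕ) < p := fun j =>
    ⟨fun h => lt_of_not_ge fun hj => (hnonneg.self_of_nhds j hj).not_gt h, hneg.self_of_nhds j⟩
  obtain ⟨hBuB, b, β, hb, hβ, hpencil⟩ := exists_basis_of_common_eigenvectors (by simp)
    (hlam uB huB).injective (hr0 uB huB) (hr uB huB) hBr.self_of_nhds
  have hμ : ∀ j, lam j uB / β j < 0 ↔ (j : ℕ) < p := fun j => by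
    rw [div_lt_iff₀ (hβ j), zero_mul, hsign]
  have hspan : stableSubspace b (fun j => lam j uB / β j) =
      Submodule.span ℝ {w | ∃ j : Fin N, (j : ℕ) < p ∧ w = r j uB} := by
    simp only [stableSubspace, hμ, hb, image, mem_ofPred_eq, eq_comm]
  obtain ⟨hself, ⟨M, hM, huM, hMp, -⟩, hhyperbolic⟩ :=
    theorem3p4_general h𝒰 hf hB huB hBuB b hpencil
  rw [finrank_stableSubspace b hp hμ] at hMp
  rw [finrank_stableSubspace b hp hμ, hspan] at hhyperbolic
  refine ⟨hself, ⟨M, hM, huM, hMp⟩, fun hpos => hhyperbolic fun j => ?_⟩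
  rcases lt_or_ge (j : ℕ) p with hj | hj
  · exact ((hμ j).2 hj).ne
  · exact (div_pos (hpos j hj) (hβ j)).ne'
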